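/- Let $D\ge 2$ and $n\ge 1$ be integers and $d=2D$. Let $X=(X_1,\dots,X_n)$ have the Dirichlet distribution $\mathcal D(1,\dots,1)$, let $\Theta_1,\dots,\Theta_n$ be i.i.d. uniform on the unit sphere of $\mathbb R^{d}$ and independent of $X$, and put $W=X_1\Theta_1+\cdots+X_n\Theta_n$, $R=\|W\|$. Write $(x)_k=x(x+1)\cdots(x+k-1)$, $(x)_0=1$. Define polynomials by $A_2(u)=4u$ and, for $m\ge 3$, $A_m'(u)=4(1-2u)A_{m-1}(u)$, $A_m(0)=0$. Then $A_D(u)=u^{D-1}B_D(u)$ with a polynomial $B_D$ of degree $\le D-2$. Let $B_1,\dots,B_{D-1}$ be the real numbers with $$\frac{(D-1)!\,B_D(u)}{4^{D-1}(1-u)^{D-1}}=\sum_{k=1}^{D-1}\frac{B_k}{(1-u)^k},$$ and define $p_i$, $n\le i\le n(D-1)$, by $\left(\sum_{k=1}^{D-1}B_kz^k\right)^n=\sum_{i=n}^{n(D-1)}p_iz^i$. Then: 1. For $0<u<1/2$, ${}_2F_1\left(\tfrac12,1;D;4u-4u^2\right)=\sum_{k=1}^{D-1}\frac{B_k}{(1-u)^k}$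 (which also determines the $B_k$). 2. For every $y\in\mathbb R^{d}$ with $\|y\|<1$, $$T_n(W)(y):=\mathbb E\left(\frac1{(1+\langle y,W\rangle)^n}\right)=\sum_{i=n}^{n(D-1)}p_i\;{}_2F_1\left(\tfrac i2,\tfrac{i+1}2;i+1;\|y\|^2\right).$$ 3. For every integer $k\ge0$, $$\mathbb E(R^{2k})=\frac{(D)_k}{(n)_{2k}}\sum_{i=n}^{n(D-1)}p_i\frac{(i)_{2k}}{(i+1)_k}.$$ 4. For every real $s>0$, $$\mathbb E(R^{2s})=\frac{(n-1)!}{(D-1)!}\sum_{i=n}^{n(D-1)}i\,p_i\,\frac{(s)_D}{(s)_{i+1}}\,\frac{(2s)_i}{(2s)_n},$$ and the right-hand side, a rational function of $s$ with a removable singularity at $s=0$, tends to $1=\mathbb E(R^0)$ as $s\to0$. 5. If $n\ge2$, the distribution of $R^2$ has a density of the form $f(v)\mathbf 1_{(0,1)}(v)$, where $f$ is a polynomial that is nonnegative on $(0,1)$. -/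

import Mathlib

open MeasureTheory ProbabilityTheory Polynomial

open scoped Nat Topology

namespace DirichletWalk

/-- Rising factorial `(x)_k = x (x + 1) ⋯ (x + k - 1)`, with `(x)_0 = 1`. -/
noncomputable def poch (x : ℝ) (k : ℕ) : ℝ := (ascPochhammer ℝ k).eval x

/-- The Dirichlet distribution `𝓓(q₁, …, qₙ)` (for `n ≥ 1` and positive `qᵢ`): the law of
`(Y₁ / S, …, Yₙ / S)`, where `Y₁, …, Yₙ` are independent, `Yᵢ` has the gamma distribution of
shape `qᵢ` and rate `1`, and `S = Y₁ + ⋯ + Yₙ`. -/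
noncomputable def dirichletMeasure {n : ℕ} (q : Fin n → ℝ) : Measure (Fin n → ℝ) :=
  (Measure.pi fun i => gammaMeasure (q i) 1).map fun y i => y i / ∑ j, y j

/-- The uniform probability distribution on the unit sphere of `ℝ^d` (`d ≥ 1`), as a measure on
`ℝ^d`: the normalised surface measure. -/
noncomputable def sphereUniform (d : ℕ) : Measure (EuclideanSpace ℝ (Fin d)) :=
  (((volume : Measure (EuclideanSpace ℝ (Fin d))).toSphere Set.univ)⁻¹ •
    (volume : Measure (EuclideanSpace ℝ (Fin d))).toSphere).map Subtype.val

/-- `X` and `Θ` are the weights and the directions of a Dirichlet random walk in `ℝ^d` governed by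
`𝓓(q₁, …, qₙ)`: `X ∼ 𝓓(q₁, …, qₙ)`, the `Θⱼ` are i.i.d. uniform on the unit sphere, and
`(Θ₁, …, Θₙ)` is independent of `X`. -/
structure IsDirichletWalk {Ω : Type*} [MeasurableSpace Ω] (P : Measure Ω) {n d : ℕ}
    (q : Fin n → ℝ) (X : Ω → Fin n → ℝ) (Θ : Fin n → Ω → EuclideanSpace ℝ (Fin d)) : Prop where
  hasLaw_weights : HasLaw X (dirichletMeasure q) P
  hasLaw_direction : ∀ j, HasLaw (Θ j) (sphereUniform d) P
  iIndepFun_direction : iIndepFun Θ P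
  indepFun : IndepFun X (fun ω j => Θ j ω) P

/-- `W = X₁ Θ₁ + ⋯ + Xₙ Θₙ`. -/
noncomputable def walk {Ω : Type*} {n d : ℕ} (X : Ω → Fin n → ℝ)
    (Θ : Fin n → Ω → EuclideanSpace ℝ (Fin d)) (ω : Ω) : EuclideanSpace ℝ (Fin d) :=
  ∑ j, X ω j • Θ j ω

/-- The transform `T_p(U)(y) = 𝔼 (1 / (1 + ⟨y, U⟩)^p)`. -/
noncomputable def stieltjesT {Ω : Type*} [MeasurableSpace Ω] (P : Measure Ω) {d : ℕ} (p : ℝ)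
    (U : Ω → EuclideanSpace ℝ (Fin d)) (y : EuclideanSpace ℝ (Fin d)) : ℝ :=
  ∫ ω, 1 / (1 + inner ℝ y (U ω)) ^ p ∂P

/-- The antiderivative vanishing at `0` of a real polynomial. -/
noncomputable def antideriv (f : ℝ[X]) : ℝ[X] :=
  f.sum fun i a => monomial (i + 1) (a / (i + 1))

/-- `polyA m` is the polynomial `A_D` for `D = m + 2`: `A_2 = 4 u` and, for `D ≥ 3`,
`A_D' = 4 (1 - 2u) A_{D-1}` with `A_D(0) = 0`. (The case `D = 2` is what this recursion gives when
started at `A_1(u) = 1 / (1 - 2u)`.) -/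
noncomputable def polyA : ℕ → ℝ[X]
  | 0 => 4 * X
  | m + 1 => antideriv (4 * (1 - 2 * X) * polyA m)

/-- The polynomial `B_D` with `A_D(u) = u^(D-1) B_D(u)`, for `D ≥ 2`. -/
noncomputable def polyB (D : ℕ) : ℝ[X] := divX^[D - 1] (polyA (D - 2))

/-- The coefficients `B_1, …, B_{D-1}` (for `D ≥ 2`) of the partial fraction expansion
`(D-1)! B_D(u) / (4^(D-1) (1-u)^(D-1)) = ∑_{k=1}^{D-1} B_k / (1-u)^k`, read off by expanding
`B_D(u)` in powers of `1 - u`. -/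
noncomputable def coeffB (D k : ℕ) : ℝ :=
  ((D - 1)! : ℝ) / 4 ^ (D - 1) * ((polyB D).comp (1 - X)).coeff (D - 1 - k)

/-- The coefficient `p_i` of `z^i` in `(∑_{k=1}^{D-1} B_k z^k)^n`. -/
noncomputable def coeffP (D n i : ℕ) : ℝ :=
  ((∑ k ∈ Finset.Icc 1 (D - 1), C (coeffB D k) * X ^ k) ^ n).coeff i

/-- The rational fraction
`s ↦ (n-1)!/(D-1)! ∑_{i=n}^{n(D-1)} i p_i (s)_D/(s)_{i+1} (2s)_i/(2s)_n`. -/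
noncomputable def mellinFraction (D n : ℕ) (s : ℝ) : ℝ :=
  ((n - 1)! : ℝ) / ((D - 1)! : ℝ) * ∑ i ∈ Finset.Icc n (n * (D - 1)),
    (i : ℝ) * coeffP D n i * (poch s D / poch s (i + 1)) * (poch (2 * s) i / poch (2 * s) n)

end DirichletWalk

/-! For `𝓓(1, …, 1)` one has `𝔼 (1 + ∑ Xⱼ aⱼ)⁻ⁿ = ∏ (1 + aⱼ)⁻¹`
(`integral_dirichletMeasure_one_div_pow`), so conditioning on the directions gives `T_n(W) =
T_1(Θ)ⁿ`. The even moments of the sphere give `T_1(Θ)(y) = ₂F₁(1/2, 1; D; ‖y‖²)`.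

Put `‖y‖² = z = 4u - 4u²`. Up to the factor `z^(D-1) / (D-1)!`, this function is a `(D-1)`-fold
antiderivative of `(1 - z)^(-1/2) = 1 / (1 - 2u)`. Since `dz = 4 (1 - 2u) du`, the square root
cancels and every later antiderivative is a polynomial in `u`: these are the `A_D`. Hence `T_1(Θ)`
is a polynomial in `(1 - u)⁻¹`, its `n`-th power is `∑ p_i (1 - u)⁻ⁱ`, and each `(1 - u)⁻ⁱ` is again
hypergeometric in `z` (`hasSum_ballotCoeff`).

Comparing coefficients along `y = t e` gives the even moments of `⟨e, W⟩`; averaging over a uniform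
`e` turns them into moments of `R`. These are values at integers of a rational function with simple
poles among `-1, -2, …`. Its polynomial part is a constant `c`, because the moments are bounded, so
the moments are those of `c δ₁ + f(v) dv` with a polynomial `f`. By Weierstrass approximation this
representation extends from `v^k` to `v^s`, which gives the Mellin transform. For `n ≥ 2` two
directions almost surely differ, so `R < 1` and `c = 0`; positivity of the law then forces `f ≥ 0`.
-/

namespace DirichletWalk

/-! ### Rising factorials. -/

lemma poch_zero (x : ℝ) : poch x 0 = 1 := by simp [poch]

lemma poch_succ (x : ℝ) (k : ℕ) : poch x (k + 1) = poch x k * (x + k) := by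
  simp [poch, ascPochhammer_succ_eval]

lemma poch_succ_left (x : ℝ) (k : ℕ) : poch x (k + 1) = x * poch (x + 1) k := by
  simp [poch, ascPochhammer_succ_left, Polynomial.eval_comp]

lemma poch_pos {x : ℝ} (hx : 0 < x) (k : ℕ) : 0 < poch x k := ascPochhammer_pos k x hx

lemma poch_natCast_succ (i k : ℕ) : poch ((i : ℝ) + 1) k = ((i + k)! : ℝ) / (i ! : ℝ) := by
  induction k with
  | zero => simp [poch_zero, Nat.factorial_ne_zero]
  | succ k ih =>
    rw [poch_succ, ih, ← add_assoc, Nat.factorial_succ]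
    push_cast
    ring

lemma poch_two_mul (x : ℝ) (k : ℕ) :
    poch x (2 * k) = 4 ^ k * (poch (x / 2) k * poch ((x + 1) / 2) k) := by
  induction k with
  | zero => simp [poch_zero]
  | succ k ih =>
    rw [mul_add, mul_one, poch_succ, poch_succ, ih, poch_succ, poch_succ]
    push_cast
    ring

lemma poch_one (k : ℕ) : poch 1 k = (k ! : ℝ) := by
  simpa using poch_natCast_succ 0 k

lemma hypergeometric_eq_tsum (a b c z : ℝ) :
    ₂F₁ a b c z = ∑' k, poch a k * poch b k / (poch c k * (k ! : ℝ)) * z ^ k := by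
  rw [ordinaryHypergeometric_eq_tsum]
  refine tsum_congr fun k => ?_
  simp only [poch, smul_eq_mul, div_eq_mul_inv, mul_inv]
  ring

/-! ### The functions `(1 - u)⁻ⁱ` as hypergeometric series -/

/-- The coefficients of `₂F₁(i/2, (i+1)/2; i+1; ·)`. -/
noncomputable def ballotCoeff (i k : ℕ) : ℝ :=
  poch i (2 * k) / (4 ^ k * (k ! : ℝ) * poch ((i : ℝ) + 1) k)

lemma ballotCoeff_zero_right (i : ℕ) : ballotCoeff i 0 = 1 := by
  simp [ballotCoeff, poch_zero]

lemma ballotCoeff_zero_left (k : ℕ) : ballotCoeff 0 (k + 1) = 0 := by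
  rw [ballotCoeff, mul_add, mul_one, poch_succ_left]
  simp

/-- Coefficientwise form of `w^(i+1) - w^i = (z/4) w^(i+2)` for `w = (1 - u)⁻¹` and `z = 4u(1 - u)`.
-/
lemma ballotCoeff_recurrence (i k : ℕ) :
    ballotCoeff (i + 2) k / 4 = ballotCoeff (i + 1) (k + 1) - ballotCoeff i (k + 1) := by
  have h1 : poch ((i + 2 : ℕ) : ℝ) (2 * k) = ((i + 1 + 2 * k)! : ℝ) / ((i + 1)! : ℝ) := by
    rw [← poch_natCast_succ]; congr 1; push_cast; ring
  have h2 : poch ((i + 1 : ℕ) : ℝ) (2 * (k + 1)) = ((i + (2 * (k + 1)))! : ℝ) / (i ! : ℝ) := by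
    rw [← poch_natCast_succ]; congr 1; push_cast; ring
  have h3 : poch (i : ℝ) (2 * (k + 1)) = i * (((i + (2 * k + 1))! : ℝ) / (i ! : ℝ)) := by
    rw [← poch_natCast_succ, ← poch_succ_left]; rfl
  rw [ballotCoeff, ballotCoeff, ballotCoeff, h1, h2, h3, poch_natCast_succ, poch_natCast_succ,
    poch_natCast_succ]
  have e1 : (i + 1 + 2 * k)! = (i + (2 * k + 1))! := by congr 1; ring
  have e2 : (i + 2 * (k + 1))! = (i + 2 * k + 2) * (i + (2 * k + 1))! := by
    rw [show i + 2 * (k + 1) = i + (2 * k + 1) + 1 by ring, Nat.factorial_succ]; ring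
  have e3 : (i + 2 + k)! = (i + k + 2) * (i + k + 1)! := by
    rw [← Nat.factorial_succ]; congr 1; ring
  have e4 : (i + 1 + (k + 1))! = (i + k + 2) * (i + k + 1)! := by
    rw [← Nat.factorial_succ]; congr 1; ring
  have e5 : (i + (k + 1))! = (i + k + 1)! := by congr 1
  have e6 : (i + 2)! = (i + 2) * ((i + 1) * i !) := by
    rw [Nat.factorial_succ, Nat.factorial_succ]
  have e7 : (i + 1)! = (i + 1) * i ! := Nat.factorial_succ i
  have e8 : (k + 1)! = (k + 1) * k ! := Nat.factorial_succ k
  rw [e1, e2, e3, e4, e5, e6, e7, e8]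
  have p1 : ((i + k + 1)! : ℝ) ≠ 0 := by positivity
  have p2 : (i ! : ℝ) ≠ 0 := by positivity
  have p3 : (k ! : ℝ) ≠ 0 := by positivity
  push_cast
  field_simp
  ring

lemma hypergeometric_ballot_eq_tsum (i : ℕ) (z : ℝ) :
    ₂F₁ ((i : ℝ) / 2) (((i : ℝ) + 1) / 2) ((i : ℝ) + 1) z = ∑' k, ballotCoeff i k * z ^ k := by
  rw [hypergeometric_eq_tsum]
  refine tsum_congr fun k => ?_
  rw [ballotCoeff, poch_two_mul, mul_assoc (4 ^ k), mul_div_mul_left _ _ (by positivity),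
    mul_comm (k ! : ℝ)]

/-! ### The series of `₂F₁(1/2, 1; D; z)` and its iterated antiderivatives -/

/-- The coefficients of `₂F₁(1/2, 1; D; ·)`. -/
noncomputable def sphereCoeff (D k : ℕ) : ℝ := poch (1 / 2) k / poch D k

lemma poch_le_poch {x y : ℝ} (hx : 0 < x) (hxy : x ≤ y) (k : ℕ) : poch x k ≤ poch y k := by
  induction k with
  | zero => simp [poch_zero]
  | succ k ih =>
    rw [poch_succ, poch_succ]
    have h1 := poch_pos hx k
    have h2 := h1.le.trans ih
    gcongr

lemma sphereCoeff_nonneg (D k : ℕ) (hD : 1 ≤ D) : 0 ≤ sphereCoeff D k := by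
  have hD' : (1 : ℝ) ≤ D := by exact_mod_cast hD
  exact div_nonneg (poch_pos (by norm_num) k).le (poch_pos (by linarith) k).le

lemma sphereCoeff_le_one (D k : ℕ) (hD : 1 ≤ D) : sphereCoeff D k ≤ 1 := by
  have hD' : (1 : ℝ) ≤ D := by exact_mod_cast hD
  exact div_le_one_of_le₀ (poch_le_poch (by norm_num) (by linarith) k)
    (poch_pos (by linarith) k).le

/-- Termwise, this is the statement that `spherePrimitive (m + 1)` has derivative `spherePrimitive
m`. -/
lemma sphereCoeff_succ_left (m k : ℕ) :
    sphereCoeff (m + 2) k / ((m + 1)! : ℝ) * ((k : ℝ) + (m + 1)) =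
      sphereCoeff (m + 1) k / (m ! : ℝ) := by
  have h := poch_succ ((m : ℝ) + 1) k
  rw [poch_succ_left] at h
  have h1 : (0 : ℝ) < poch ((m : ℝ) + 1) k := poch_pos (by positivity) k
  have h2 : (0 : ℝ) < poch ((m : ℝ) + 1 + 1) k := poch_pos (by positivity) k
  have e1 : ((m + 1 : ℕ) : ℝ) = (m : ℝ) + 1 := by push_cast; ring
  have e2 : ((m + 2 : ℕ) : ℝ) = (m : ℝ) + 1 + 1 := by push_cast; ring
  have hm : (0 : ℝ) < m ! := by positivity
  rw [sphereCoeff, sphereCoeff, e1, e2, Nat.factorial_succ]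
  push_cast
  field_simp
  linear_combination (-poch (1 / 2) k) * h

lemma hypergeometric_sphere_eq_tsum (D : ℕ) (z : ℝ) :
    ₂F₁ (1 / 2 : ℝ) 1 (D : ℝ) z = ∑' k, sphereCoeff D k * z ^ k := by
  rw [hypergeometric_eq_tsum]
  refine tsum_congr fun k => ?_
  rw [poch_one, mul_div_mul_right _ _ (by positivity), sphereCoeff]

lemma summable_sphereCoeff (D : ℕ) (hD : 1 ≤ D) {z : ℝ} (hz : |z| < 1) :
    Summable fun k => sphereCoeff D k * z ^ k := by
  refine Summable.of_norm_bounded (summable_geometric_of_lt_one (abs_nonneg z) hz) fun k => ?_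
  rw [Real.norm_eq_abs, abs_mul, abs_of_nonneg (sphereCoeff_nonneg D k hD), abs_pow]
  exact mul_le_of_le_one_left (by positivity) (sphereCoeff_le_one D k hD)

/-- `z^m ₂F₁(1/2, 1; m + 1; z) / m!`, an `m`-th iterated antiderivative of `(1 - z)^(-1/2)`. -/
noncomputable def spherePrimitive (m : ℕ) (z : ℝ) : ℝ :=
  ∑' k, sphereCoeff (m + 1) k / (m ! : ℝ) * z ^ (k + m)

lemma spherePrimitive_eq (m : ℕ) (z : ℝ) :
    spherePrimitive m z = z ^ m / (m ! : ℝ) * ₂F₁ (1 / 2 : ℝ) 1 ((m + 1 : ℕ) : ℝ) z := by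
  rw [hypergeometric_sphere_eq_tsum, ← tsum_mul_left, spherePrimitive]
  refine tsum_congr fun k => ?_
  rw [pow_add]
  ring

lemma spherePrimitive_succ_zero (m : ℕ) : spherePrimitive (m + 1) 0 = 0 := by
  simp [spherePrimitive]

lemma hasDerivAt_spherePrimitive (m : ℕ) {z : ℝ} (hz : |z| < 1) :
    HasDerivAt (spherePrimitive (m + 1)) (spherePrimitive m z) z := by
  -- On the ball of radius `r` the differentiated series is dominated by `∑ r^k`.
  obtain ⟨r, hr, hr1⟩ := exists_between hz
  have hr0 : 0 ≤ r := (abs_nonneg z).trans hr.le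
  refine hasDerivAt_tsum_of_isPreconnected (t := Metric.ball (0 : ℝ) r)
    (g := fun k (z : ℝ) => sphereCoeff (m + 2) k / ((m + 1)! : ℝ) * z ^ (k + (m + 1)))
    (g' := fun k (z : ℝ) => sphereCoeff (m + 1) k / (m ! : ℝ) * z ^ (k + m))
    (u := fun k => r ^ k) (y₀ := 0) (summable_geometric_of_lt_one hr0 hr1) Metric.isOpen_ball
    (convex_ball _ _).isPreconnected ?_ ?_ ?_ ?_ ?_
  · intro k y _
    have := (hasDerivAt_pow (k + (m + 1)) y).const_mul (sphereCoeff (m + 2) k / ((m + 1)! : ℝ))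
    refine this.congr_deriv ?_
    rw [← sphereCoeff_succ_left m k, ← mul_assoc]
    push_cast
    rfl
  · intro k y hy
    rw [mem_ball_zero_iff, Real.norm_eq_abs] at hy
    have h0 := sphereCoeff_nonneg (m + 1) k (by lia)
    have h1 := sphereCoeff_le_one (m + 1) k (by lia)
    have hm : (1 : ℝ) ≤ m ! := by exact_mod_cast Nat.one_le_iff_ne_zero.2 (Nat.factorial_ne_zero m)
    rw [Real.norm_eq_abs, abs_mul, abs_of_nonneg (by positivity), abs_pow, pow_add]
    have h2 : |y| ^ k ≤ r ^ k := pow_le_pow_left₀ (abs_nonneg y) hy.le k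
    have h3 : |y| ^ m ≤ 1 := pow_le_one₀ (abs_nonneg y) (hy.trans hr1).le
    calc _ ≤ 1 * (r ^ k * 1) := by
          gcongr
          exact div_le_one_of_le₀ (h1.trans hm) (by positivity)
      _ = r ^ k := by ring
  · simpa using (abs_nonneg z).trans_lt hr
  · refine summable_of_ne_finset_zero (s := ∅) fun k _ => ?_
    simp
  · simpa using hr

/-- The binomial series: for `m = 0` the coefficients are `(1/2)_k / k!`. -/
lemma spherePrimitive_zero {z : ℝ} (hz : |z| < 1) :
    spherePrimitive 0 z = 1 / (1 - z) ^ (1 / 2 : ℝ) := by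
  have h := (Real.one_div_one_sub_rpow_hasFPowerSeriesOnBall_zero (1 / 2)).hasSum (y := z)
    (by simpa [enorm_eq_nnnorm, ← NNReal.coe_lt_coe] using hz)
  rw [zero_add] at h
  rw [← h.tsum_eq, spherePrimitive]
  refine tsum_congr fun k => ?_
  have h1 := Ring.factorial_nsmul_multichoose_eq_ascPochhammer (1 / 2 : ℝ) k
  rw [ascPochhammer_smeval_eq_eval, nsmul_eq_mul] at h1
  have h2 : Ring.choose ((1 / 2 : ℝ) + k - 1) k = Ring.multichoose (1 / 2 : ℝ) k := by
    rw [Ring.choose]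
    congr 1
    ring
  rw [FormalMultilinearSeries.ofScalars_apply_eq, smul_eq_mul, h2, sphereCoeff, poch, ← h1]
  have hk : (k ! : ℝ) ≠ 0 := by positivity
  simp [poch_one, mul_div_cancel_left₀ _ hk]

/-! ### The polynomials `A_D` and `B_D` -/

lemma antideriv_add (f g : ℝ[X]) : antideriv (f + g) = antideriv f + antideriv g :=
  Polynomial.sum_add_index _ _ _ (by simp) fun i a b => by simp [add_div]

lemma antideriv_monomial (i : ℕ) (a : ℝ) :
    antideriv (monomial i a) = monomial (i + 1) (a / (i + 1)) :=
  Polynomial.sum_monomial_index _ _ (by simp)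

lemma derivative_antideriv (f : ℝ[X]) : derivative (antideriv f) = f := by
  induction f using Polynomial.induction_on' with
  | add p q hp hq => rw [antideriv_add, derivative_add, hp, hq]
  | monomial i a =>
    rw [antideriv_monomial, derivative_monomial]
    congr 1
    push_cast
    field_simp

lemma coeff_antideriv_zero (f : ℝ[X]) : (antideriv f).coeff 0 = 0 := by
  induction f using Polynomial.induction_on' with
  | add p q hp hq => rw [antideriv_add, coeff_add, hp, hq, add_zero]
  | monomial i a => rw [antideriv_monomial, coeff_monomial, if_neg (by lia)]

lemma coeff_antideriv_succ (f : ℝ[X]) (k : ℕ) :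
    (antideriv f).coeff (k + 1) = f.coeff k / (k + 1) := by
  have h := congrArg (fun p => coeff p k) (derivative_antideriv f)
  simp only [coeff_derivative] at h
  rw [← h]
  field_simp

lemma natDegree_antideriv_le (f : ℝ[X]) : (antideriv f).natDegree ≤ f.natDegree + 1 := by
  rw [natDegree_le_iff_coeff_eq_zero]
  intro N hN
  obtain ⟨k, rfl⟩ : ∃ k, N = k + 1 := ⟨N - 1, by lia⟩
  rw [coeff_antideriv_succ, coeff_eq_zero_of_natDegree_lt (by lia), zero_div]

lemma natDegree_polyA_le (m : ℕ) : (polyA m).natDegree ≤ 2 * m + 1 := by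
  induction m with
  | zero =>
    rw [polyA]
    compute_degree
  | succ m ih =>
    rw [polyA]
    refine (natDegree_antideriv_le _).trans ?_
    have h1 : (4 * (1 - 2 * X) : ℝ[X]).natDegree ≤ 1 := by compute_degree
    have h2 := natDegree_mul_le (p := (4 * (1 - 2 * X) : ℝ[X])) (q := polyA m)
    lia

lemma coeff_polyA_of_le (m k : ℕ) (hk : k ≤ m) : (polyA m).coeff k = 0 := by
  induction m generalizing k with
  | zero =>
    obtain rfl : k = 0 := by lia
    simp [polyA]
  | succ m ih =>
    rw [polyA]
    cases k with
    | zero => exact coeff_antideriv_zero _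
    | succ k =>
      rw [coeff_antideriv_succ, show (4 * (1 - 2 * X) * polyA m : ℝ[X]) =
        C 4 * (polyA m - C 2 * (X * polyA m)) by simp only [map_ofNat]; ring, coeff_C_mul, coeff_sub,
        coeff_C_mul, ih k (by lia)]
      cases k with
      | zero => simp
      | succ k => simp [coeff_X_mul, ih k (by lia)]

lemma coeff_divX_iterate (p : ℝ[X]) (k j : ℕ) : (divX^[k] p).coeff j = p.coeff (j + k) := by
  induction k generalizing j with
  | zero => rfl
  | succ k ih =>
    rw [Function.iterate_succ_apply', coeff_divX, ih]
    congr 1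
    ring

lemma polyA_eq_mul (m : ℕ) : polyA m = polyB (m + 2) * X ^ (m + 1) := by
  ext k
  rw [coeff_mul_X_pow']
  split_ifs with h
  · rw [polyB, coeff_divX_iterate]
    congr 1
    simp
    lia
  · exact coeff_polyA_of_le m k (by lia)

lemma natDegree_polyB_le (m : ℕ) : (polyB (m + 2)).natDegree ≤ m := by
  rw [natDegree_le_iff_coeff_eq_zero]
  intro N hN
  rw [polyB, coeff_divX_iterate]
  refine coeff_eq_zero_of_natDegree_lt ?_
  have := natDegree_polyA_le m
  simp
  lia

/-- Both sides vanish at `u = 0` and have the same derivative: by the chain rule, `dz = 4 (1 - 2u)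
du` reproduces the recursion of `polyA`. In the base case `√(1 - z) = 1 - 2u` cancels this factor
and leaves the constant `4`. -/
lemma eval_polyA_eq_spherePrimitive (m : ℕ) {u : ℝ} (h0 : 0 ≤ u) (h1 : u < 1 / 2) :
    spherePrimitive (m + 1) (4 * u - 4 * u ^ 2) = (polyA m).eval u := by
  have habs : ∀ x ∈ Set.Icc 0 u, |4 * x - 4 * x ^ 2| < 1 := by
    rintro x ⟨hx0, hx1⟩
    rw [abs_lt]
    constructor <;> nlinarith
  have hderiv : ∀ (m : ℕ), ∀ x ∈ Set.Icc 0 u,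
      HasDerivAt (fun x : ℝ => spherePrimitive (m + 1) (4 * x - 4 * x ^ 2))
        (spherePrimitive m (4 * x - 4 * x ^ 2) * (4 * (1 - 2 * x))) x := by
    intro m x hx
    have h2 : HasDerivAt (fun x : ℝ => 4 * x - 4 * x ^ 2) (4 * (1 - 2 * x)) x := by
      refine (((hasDerivAt_id x).const_mul 4).sub ((hasDerivAt_pow 2 x).const_mul 4)).congr_deriv ?_
      norm_num
      ring
    exact (hasDerivAt_spherePrimitive m (habs x hx)).comp x h2
  suffices H : ∀ y ∈ Set.Icc 0 u,
      spherePrimitive (m + 1) (4 * y - 4 * y ^ 2) = (polyA m).eval y from H u ⟨h0, le_rfl⟩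
  induction m with
  | zero =>
    refine eq_of_has_deriv_right_eq (f' := fun _ => 4) (fun x hx => ?_) (fun x hx => ?_)
      (fun x hx => (hderiv 0 x hx).continuousAt.continuousWithinAt)
      (polyA 0).continuous.continuousOn ?_
    · have hx' : x ∈ Set.Icc 0 u := ⟨hx.1, hx.2.le⟩
      refine ((hderiv 0 x hx').congr_deriv ?_).hasDerivWithinAt
      have hx2 : 0 < 1 - 2 * x := by linarith [hx.2]
      rw [spherePrimitive_zero (habs x hx'), ← Real.sqrt_eq_rpow,
        show 1 - (4 * x - 4 * x ^ 2) = (1 - 2 * x) ^ 2 by ring, Real.sqrt_sq hx2.le]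
      field_simp
    · refine (((polyA 0).hasDerivAt x).congr_deriv ?_).hasDerivWithinAt
      simp [polyA]
    · simp [spherePrimitive_succ_zero, polyA]
  | succ m ih =>
    refine eq_of_has_deriv_right_eq
      (f' := fun x => spherePrimitive (m + 1) (4 * x - 4 * x ^ 2) * (4 * (1 - 2 * x)))
      (fun x hx => (hderiv _ x ⟨hx.1, hx.2.le⟩).hasDerivWithinAt) (fun x hx => ?_)
      (fun x hx => (hderiv _ x hx).continuousAt.continuousWithinAt)
      (polyA _).continuous.continuousOn ?_
    · refine (((polyA (m + 1)).hasDerivAt x).congr_deriv ?_).hasDerivWithinAt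
      rw [ih x ⟨hx.1, hx.2.le⟩, polyA, derivative_antideriv]
      simp
      ring
    · rw [show (4 * 0 - 4 * 0 ^ 2 : ℝ) = 0 by norm_num, spherePrimitive_succ_zero,
        ← coeff_zero_eq_eval_zero, polyA, coeff_antideriv_zero]

/-- The polynomial `∑ B_k z^k`. -/
noncomputable def generatingB (D : ℕ) : ℝ[X] :=
  ∑ k ∈ Finset.Icc 1 (D - 1), C (coeffB D k) * X ^ k

lemma eval_generatingB (D : ℕ) (z : ℝ) :
    (generatingB D).eval z = ∑ k ∈ Finset.Icc 1 (D - 1), coeffB D k * z ^ k := by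
  simp [generatingB, eval_finsetSum]

/-- Expand `polyB` in powers of `1 - u` and divide; the degree bound `D - 2` ensures that only
exponents `k ≥ 1` remain. -/
lemma sum_coeffB_div_eq (m : ℕ) {u : ℝ} (hu : u < 1) :
    ∑ k ∈ Finset.Icc 1 (m + 1), coeffB (m + 2) k / (1 - u) ^ k =
      ((m + 1)! : ℝ) / 4 ^ (m + 1) * (polyB (m + 2)).eval u / (1 - u) ^ (m + 1) := by
  set Q := (polyB (m + 2)).comp (1 - X) with hQ
  have hdeg : Q.natDegree < m + 1 := by
    refine Nat.lt_succ_of_le ((natDegree_comp_le).trans ?_)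
    have h1 : (1 - X : ℝ[X]).natDegree ≤ 1 := by compute_degree
    calc _ ≤ (polyB (m + 2)).natDegree * 1 := Nat.mul_le_mul_left _ h1
      _ ≤ m := by simpa using natDegree_polyB_le m
  have heval : (polyB (m + 2)).eval u = Q.eval (1 - u) := by simp [hQ, eval_comp]
  have hu' : 1 - u ≠ 0 := by linarith
  rw [heval, eval_eq_sum_range' hdeg, ← Finset.sum_range_reflect, Finset.mul_sum, Finset.sum_div]
  refine Finset.sum_nbij' (fun i => i - 1) (fun i => i + 1) ?_ ?_ ?_ ?_ ?_
  · intro i hi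
    simp only [Finset.mem_Icc, Finset.mem_range] at hi ⊢
    lia
  · intro i hi
    simp only [Finset.mem_Icc, Finset.mem_range] at hi ⊢
    lia
  · intro i hi
    simp only [Finset.mem_Icc] at hi
    lia
  · intro i _
    simp
  · intro i hi
    simp only [Finset.mem_Icc] at hi
    obtain ⟨j, rfl⟩ : ∃ j, i = j + 1 := ⟨i - 1, by lia⟩
    rw [coeffB, ← hQ]
    have e1 : m + 2 - 1 - (j + 1) = m - j := by lia
    have e2 : m + 1 - 1 - (j + 1 - 1) = m - j := by lia
    have e3 : m + 2 - 1 = m + 1 := by lia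
    have e4 : (1 - u) ^ (m + 1) = (1 - u) ^ (m - j) * (1 - u) ^ (j + 1) := by
      rw [← pow_add]; congr 1; lia
    rw [e1, e2, e3, e4]
    field_simp

/-- With `z = 4u(1 - u)`, the factor `u^(D-1)` of `z^(D-1)` cancels the one in `A_D = u^(D-1) B_D`;
this is where `u ≠ 0` is used. -/
lemma generatingB_eval_eq_hypergeometric_of_pos (D : ℕ) (hD : 2 ≤ D) {u : ℝ} (h0 : 0 < u)
    (h1 : u < 1 / 2) :
    ₂F₁ (1 / 2 : ℝ) 1 (D : ℝ) (4 * u - 4 * u ^ 2) = (generatingB D).eval (1 - u)⁻¹ := by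
  obtain ⟨m, rfl⟩ : ∃ m, D = m + 2 := ⟨D - 2, by lia⟩
  have h := eval_polyA_eq_spherePrimitive m h0.le h1
  rw [spherePrimitive_eq, polyA_eq_mul, eval_mul, eval_pow, eval_X,
    show 4 * u - 4 * u ^ 2 = 4 * u * (1 - u) by ring, mul_pow, mul_pow] at h
  have hu : 0 < 1 - u := by linarith
  have hs := sum_coeffB_div_eq m (show u < 1 by linarith)
  rw [eval_generatingB]
  simp only [inv_pow, ← div_eq_mul_inv]
  rw [show m + 2 - 1 = m + 1 by lia, hs, show 4 * u - 4 * u ^ 2 = 4 * u * (1 - u) by ring]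
  have hf : ((m + 1)! : ℝ) ≠ 0 := by positivity
  field_simp at h ⊢
  linear_combination h

/-- Let `u → 0⁺` in the preceding identity. This normalisation `∑ B_k = 1` later yields `∑ p_i = 1`.
-/
lemma generatingB_eval_one (D : ℕ) (hD : 2 ≤ D) : (generatingB D).eval 1 = 1 := by
  have hc : Filter.Tendsto (fun u : ℝ => (generatingB D).eval (1 - u)⁻¹) (𝓝[>] 0)
      (𝓝 ((generatingB D).eval 1)) := by
    have h : ContinuousAt (fun u : ℝ => (generatingB D).eval (1 - u)⁻¹) 0 :=
      (generatingB D).continuous.continuousAt.comp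
        ((continuousAt_const.sub continuousAt_id).inv₀ (by simp))
    have h' := h.tendsto
    simp only [sub_zero, inv_one] at h'
    exact h'.mono_left nhdsWithin_le_nhds
  have hs : Filter.Tendsto (fun u : ℝ => ₂F₁ (1 / 2 : ℝ) 1 (D : ℝ) (4 * u - 4 * u ^ 2)) (𝓝[>] 0)
      (𝓝 1) := by
    have h : ContinuousAt (fun u : ℝ => ∑' k, sphereCoeff D k * (4 * u - 4 * u ^ 2) ^ k) 0 := by
      refine ContinuousAt.comp (g := fun z : ℝ => ∑' k, sphereCoeff D k * z ^ k)
        (f := fun u : ℝ => 4 * u - 4 * u ^ 2) ?_ (by fun_prop)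
      have hon : ContinuousOn (fun z : ℝ => ∑' k, sphereCoeff D k * z ^ k)
          (Metric.ball 0 (1 / 2)) := by
        refine continuousOn_tsum (u := fun k => (1 / 2 : ℝ) ^ k) (fun k => by fun_prop)
          (summable_geometric_of_lt_one (by norm_num) (by norm_num)) fun k z hz => ?_
        rw [mem_ball_zero_iff, Real.norm_eq_abs] at hz
        rw [Real.norm_eq_abs, abs_mul, abs_of_nonneg (sphereCoeff_nonneg D k (by lia)), abs_pow]
        calc _ ≤ 1 * (1 / 2 : ℝ) ^ k := by
              gcongr
              exact sphereCoeff_le_one D k (by lia)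
          _ = _ := one_mul _
      refine hon.continuousAt (Metric.isOpen_ball.mem_nhds ?_)
      norm_num
    have h' := h.tendsto
    simp only [← hypergeometric_sphere_eq_tsum] at h'
    rw [show (4 * 0 - 4 * 0 ^ 2 : ℝ) = 0 by norm_num, ordinaryHypergeometric_zero] at h'
    exact h'.mono_left nhdsWithin_le_nhds
  refine tendsto_nhds_unique hc (hs.congr' ?_)
  filter_upwards [Ioo_mem_nhdsGT (show (0 : ℝ) < 1 / 2 by norm_num)] with u hu
  exact generatingB_eval_eq_hypergeometric_of_pos D hD hu.1 hu.2

lemma generatingB_eval_eq_hypergeometric (D : ℕ) (hD : 2 ≤ D) {u : ℝ} (h0 : 0 ≤ u)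
    (h1 : u < 1 / 2) :
    ₂F₁ (1 / 2 : ℝ) 1 (D : ℝ) (4 * u - 4 * u ^ 2) = (generatingB D).eval (1 - u)⁻¹ := by
  rcases h0.eq_or_lt with rfl | h0
  · rw [show (4 * 0 - 4 * 0 ^ 2 : ℝ) = 0 by norm_num, ordinaryHypergeometric_zero, sub_zero,
      inv_one, generatingB_eval_one D hD]
  · exact generatingB_eval_eq_hypergeometric_of_pos D hD h0 h1

lemma hasSum_sphereCoeff (D : ℕ) (hD : 2 ≤ D) {u : ℝ} (h0 : 0 ≤ u) (h1 : u < 1 / 2) :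
    HasSum (fun k => sphereCoeff D k * (4 * u - 4 * u ^ 2) ^ k)
      ((generatingB D).eval (1 - u)⁻¹) := by
  rw [← generatingB_eval_eq_hypergeometric D hD h0 h1, hypergeometric_sphere_eq_tsum]
  refine (summable_sphereCoeff D (by lia) ?_).hasSum
  rw [abs_lt]
  constructor <;> nlinarith

/-- The case `D = 2`, that is `₂F₁(1/2, 1; 2; z) = (1 - u)⁻¹`, is the base case `i = 1` for the
powers of `(1 - u)⁻¹`. -/
lemma generatingB_two : generatingB 2 = X := by
  have hA : polyA 0 = C 4 * X := by rw [polyA, map_ofNat]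
  have hB : polyB 2 = C 4 := by
    ext k
    rw [polyB, coeff_divX_iterate, hA, coeff_C_mul, coeff_X, coeff_C]
    rcases k with _ | k <;> simp
  have h1 : coeffB 2 1 = 1 := by simp [coeffB, hB]
  simp [generatingB, h1]

lemma ballotCoeff_one (k : ℕ) : ballotCoeff 1 k = sphereCoeff 2 k := by
  have h : poch (1 : ℝ) k = (k ! : ℝ) := poch_one k
  rw [ballotCoeff, sphereCoeff, poch_two_mul]
  have hk : (k ! : ℝ) ≠ 0 := by positivity
  norm_num
  rw [h]
  field_simp

lemma hasSum_ballotCoeff (i : ℕ) {u : ℝ} (h0 : 0 ≤ u) (h1 : u < 1 / 2) :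
    HasSum (fun k => ballotCoeff i k * (4 * u - 4 * u ^ 2) ^ k) ((1 - u)⁻¹ ^ i) := by
  rcases h0.eq_or_lt with rfl | h0
  · have h := hasSum_single (f := fun k => ballotCoeff i k * (4 * 0 - 4 * 0 ^ 2 : ℝ) ^ k) 0
      fun k hk => by simp [hk]
    simpa [ballotCoeff_zero_right] using h
  induction i using Nat.twoStepInduction with
  | zero =>
    have h := hasSum_single (f := fun k => ballotCoeff 0 k * (4 * u - 4 * u ^ 2 : ℝ) ^ k) 0
      fun k hk => by
        obtain ⟨j, rfl⟩ := Nat.exists_eq_succ_of_ne_zero hk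
        simp [ballotCoeff_zero_left]
    simpa [ballotCoeff_zero_right] using h
  | one =>
    have h := hasSum_sphereCoeff 2 le_rfl h0.le h1
    simpa [generatingB_two, ballotCoeff_one] using h
  | more i ih1 ih2 =>
    have hz : 4 * u - 4 * u ^ 2 ≠ 0 := by nlinarith
    have hu : 1 - u ≠ 0 := by linarith
    -- The constant terms are both `1` and cancel, so the difference of the two series can be
    -- shifted and divided by `z/4`.
    have h := (hasSum_nat_add_iff' 1).2 (ih2.sub ih1)
    have h' := h.mul_left (4 / (4 * u - 4 * u ^ 2))
    have hv : (1 - u)⁻¹ ^ (i + 2) = 4 / (4 * u - 4 * u ^ 2) *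
        ((1 - u)⁻¹ ^ (i + 1) - (1 - u)⁻¹ ^ i - (1 * 1 - 1 * 1)) := by
      rw [inv_pow, inv_pow, inv_pow, show 4 * u - 4 * u ^ 2 = 4 * u * (1 - u) by ring]
      field_simp
      ring
    rw [Finset.sum_range_one, ballotCoeff_zero_right, ballotCoeff_zero_right, pow_zero] at h'
    rw [hv]
    refine Eq.subst (motive := fun g => HasSum g _) (funext fun k => ?_) h'
    have hr : ballotCoeff (i + 2) k = 4 * (ballotCoeff (i + 1) (k + 1) - ballotCoeff i (k + 1)) := by
      linarith [ballotCoeff_recurrence i k]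
    rw [hr]
    field_simp
    ring

/-! ### Moments of the uniform distribution on the sphere -/

lemma integral_Ioi_pow_mul_exp_neg_sq (m : ℕ) :
    ∫ r in Set.Ioi (0 : ℝ), r ^ m * Real.exp (-r ^ 2) = 1 / 2 * Real.Gamma ((m + 1) / 2) := by
  have hm : (-1 : ℝ) < m := by linarith [(Nat.cast_nonneg m : (0 : ℝ) ≤ m)]
  rw [← integral_rpow_mul_exp_neg_rpow (by norm_num) hm]
  refine setIntegral_congr_fun measurableSet_Ioi fun r _ => ?_
  simp only [Real.rpow_natCast, Real.rpow_two]

lemma integral_pow_mul_exp_neg_sq (k : ℕ) :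
    ∫ x : ℝ, x ^ (2 * k) * Real.exp (-x ^ 2) = Real.Gamma (k + 1 / 2) := by
  have h := integral_comp_abs (f := fun r => r ^ (2 * k) * Real.exp (-r ^ 2))
  simp only [sq_abs, (even_two_mul k).pow_abs] at h
  rw [h, integral_Ioi_pow_mul_exp_neg_sq]
  push_cast
  rw [show ((2 : ℝ) * k + 1) / 2 = k + 1 / 2 by ring]
  ring

lemma gamma_add_nat {x : ℝ} (hx : 0 < x) (k : ℕ) :
    Real.Gamma (x + k) = poch x k * Real.Gamma x := by
  induction k with
  | zero => simp [poch_zero]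
  | succ k ih =>
    rw [Nat.cast_succ, ← add_assoc, Real.Gamma_add_one (by positivity), ih, poch_succ]
    ring

/-- Polar coordinates. Computing the same Gaussian integral in Cartesian coordinates then gives the
spherical moments. -/
lemma integral_inner_pow_mul_exp_eq_toSphere {d : ℕ} (hd : 0 < d)
    (y : EuclideanSpace ℝ (Fin d)) (m : ℕ) :
    ∫ x : EuclideanSpace ℝ (Fin d), inner ℝ y x ^ m * Real.exp (-‖x‖ ^ 2) =
      (∫ θ, inner ℝ y (θ : EuclideanSpace ℝ (Fin d)) ^ m
        ∂(volume : Measure (EuclideanSpace ℝ (Fin d))).toSphere) *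
      ∫ r in Set.Ioi (0 : ℝ), r ^ (d - 1 + m) * Real.exp (-r ^ 2) := by
  have : Nonempty (Fin d) := ⟨⟨0, hd⟩⟩
  have h1 := (volume : Measure (EuclideanSpace ℝ (Fin d))).measurePreserving_homeomorphUnitSphereProd
    |>.integral_comp (Homeomorph.measurableEmbedding _)
      (fun p => inner ℝ y (p.1 : EuclideanSpace ℝ (Fin d)) ^ m *
        ((p.2 : ℝ) ^ m * Real.exp (-(p.2 : ℝ) ^ 2)))
  rw [integral_prod_mul (fun p : Metric.sphere (0 : EuclideanSpace ℝ (Fin d)) 1 =>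
      inner ℝ y (p : EuclideanSpace ℝ (Fin d)) ^ m)
      (fun p : Set.Ioi (0 : ℝ) => (p : ℝ) ^ m * Real.exp (-(p : ℝ) ^ 2))] at h1
  have h2 : ∫ p : Set.Ioi (0 : ℝ), (p : ℝ) ^ m * Real.exp (-(p : ℝ) ^ 2)
      ∂(Measure.volumeIoiPow (d - 1)) =
      ∫ r in Set.Ioi (0 : ℝ), r ^ (d - 1 + m) * Real.exp (-r ^ 2) := by
    rw [Measure.volumeIoiPow, integral_withDensity_eq_integral_toReal_smul (by fun_prop) (by simp),
      integral_subtype_comap measurableSet_Ioi (fun r : ℝ => (ENNReal.ofReal (r ^ (d - 1))).toReal •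
        (r ^ m * Real.exp (-r ^ 2)))]
    refine setIntegral_congr_fun measurableSet_Ioi fun r hr => ?_
    have hr' : (0 : ℝ) < r := hr
    simp only [smul_eq_mul, ENNReal.toReal_ofReal (pow_pos hr' _).le, pow_add]
    ring
  rw [finrank_euclideanSpace, Fintype.card_fin, h2] at h1
  -- Polar coordinates miss only the origin, a null set.
  rw [← h1, ← setIntegral_univ, ← setIntegral_congr_set (μ := volume)
    (s := ({0}ᶜ : Set (EuclideanSpace ℝ (Fin d)))) ?_]
  · rw [← integral_subtype_comap (measurableSet_singleton _).compl]
    refine integral_congr_ae (ae_of_all _ fun x => ?_)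
    have hx : (0 : ℝ) < ‖(x : EuclideanSpace ℝ (Fin d))‖ := norm_pos_iff.2 x.2
    simp only [homeomorphUnitSphereProd_apply_fst_coe, homeomorphUnitSphereProd_apply_snd_coe,
      real_inner_smul_right, mul_pow, inv_pow]
    field_simp
  · rw [ae_eq_univ, compl_compl]
    exact measure_singleton _

lemma integral_inner_pow_mul_exp {d : ℕ} (y : EuclideanSpace ℝ (Fin (d + 1))) (k : ℕ) :
    ∫ x : EuclideanSpace ℝ (Fin (d + 1)), inner ℝ y x ^ (2 * k) * Real.exp (-‖x‖ ^ 2) =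
      ‖y‖ ^ (2 * k) * Real.Gamma (k + 1 / 2) * Real.Gamma (1 / 2) ^ d := by
  set e : EuclideanSpace ℝ (Fin (d + 1)) := EuclideanSpace.single 0 ‖y‖ with he
  have hnorm : ‖e‖ = ‖y‖ := by simp [he]
  -- The reflection exchanging `e` and `y` reduces to a multiple of the first coordinate, after
  -- which the integral is a product.
  set f : EuclideanSpace ℝ (Fin (d + 1)) ≃ₗᵢ[ℝ] EuclideanSpace ℝ (Fin (d + 1)) :=
    (ℝ ∙ (e - y))ᗮ.reflection
  have hf : f e = y := Submodule.reflection_sub hnorm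
  rw [← f.measurePreserving.integral_comp f.toHomeomorph.measurableEmbedding]
  have h1 : ∀ x, inner ℝ y (f x) = ‖y‖ * x 0 := by
    intro x
    rw [← hf, LinearIsometryEquiv.inner_map_map, hf, he, EuclideanSpace.inner_single_left]
    simp
  simp only [h1, LinearIsometryEquiv.norm_map]
  rw [← (EuclideanSpace.volume_preserving_symm_measurableEquiv_toLp (Fin (d + 1))).symm.integral_comp
    (MeasurableEquiv.measurableEmbedding _)]
  have h2 : ∀ x : Fin (d + 1) → ℝ, (‖y‖ * x 0) ^ (2 * k) * Real.exp (-∑ i, x i ^ 2) =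
      ‖y‖ ^ (2 * k) * ∏ i, x i ^ (if i = 0 then 2 * k else 0) * Real.exp (-x i ^ 2) := by
    intro x
    rw [Finset.prod_mul_distrib, ← Real.exp_sum, Finset.sum_neg_distrib, mul_pow,
      Fin.prod_univ_succ]
    simp [mul_assoc]
  simp only [MeasurableEquiv.symm_symm, EuclideanSpace.norm_sq_eq, Real.norm_eq_abs, sq_abs]
  refine (integral_congr_ae (ae_of_all _ h2)).trans ?_
  rw [integral_const_mul, integral_fintype_prod_volume_eq_prod
    (f := fun i (v : ℝ) => v ^ (if i = 0 then 2 * k else 0) * Real.exp (-v ^ 2)),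
    Fin.prod_univ_succ]
  have h3 := integral_pow_mul_exp_neg_sq 0
  simp only [mul_zero, pow_zero, one_mul, Nat.cast_zero, zero_add] at h3
  simp [integral_pow_mul_exp_neg_sq, h3, mul_assoc]

lemma integral_inner_pow_mul_exp_odd {d : ℕ} (y : EuclideanSpace ℝ (Fin d)) {m : ℕ}
    (hm : Odd m) :
    ∫ x : EuclideanSpace ℝ (Fin d), inner ℝ y x ^ m * Real.exp (-‖x‖ ^ 2) = 0 := by
  have h := integral_neg_eq_self (μ := (volume : Measure (EuclideanSpace ℝ (Fin d))))
    (fun x => inner ℝ y x ^ m * Real.exp (-‖x‖ ^ 2))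
  simp only [inner_neg_right, hm.neg_pow, norm_neg, neg_mul, integral_neg] at h
  linarith

lemma integral_sphereUniform (d : ℕ) (f : EuclideanSpace ℝ (Fin d) → ℝ) :
    ∫ θ, f θ ∂(sphereUniform d) =
      ((volume : Measure (EuclideanSpace ℝ (Fin d))).toSphere Set.univ).toReal⁻¹ *
        ∫ θ, f (θ : EuclideanSpace ℝ (Fin d))
          ∂(volume : Measure (EuclideanSpace ℝ (Fin d))).toSphere := by
  rw [sphereUniform, (MeasurableEmbedding.subtype_coe Metric.isClosed_sphere.measurableSet).integral_map,
    integral_smul_measure, ENNReal.toReal_inv, smul_eq_mul]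

lemma isProbabilityMeasure_sphereUniform {d : ℕ} (hd : 0 < d) :
    IsProbabilityMeasure (sphereUniform d) := by
  have : Nonempty (Fin d) := ⟨⟨0, hd⟩⟩
  have h : IsProbabilityMeasure (((volume : Measure (EuclideanSpace ℝ (Fin d))).toSphere Set.univ)⁻¹ •
      (volume : Measure (EuclideanSpace ℝ (Fin d))).toSphere) := by
    refine ⟨?_⟩
    rw [Measure.smul_apply, smul_eq_mul]
    exact ENNReal.inv_mul_cancel (Measure.measure_univ_ne_zero.2 (Measure.toSphere_ne_zero _))
      (measure_ne_top _ _)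
  exact Measure.isProbabilityMeasure_map measurable_subtype_coe.aemeasurable

lemma ae_norm_eq_one_sphereUniform (d : ℕ) : ∀ᵐ θ ∂(sphereUniform d), ‖θ‖ = 1 := by
  rw [sphereUniform, (MeasurableEmbedding.subtype_coe
    Metric.isClosed_sphere.measurableSet).ae_map_iff]
  exact ae_of_all _ fun θ => by simp

lemma integral_inner_pow_sphereUniform {D : ℕ} (hD : 1 ≤ D)
    (y : EuclideanSpace ℝ (Fin (2 * D))) (k : ℕ) :
    ∫ θ, inner ℝ y θ ^ (2 * k) ∂(sphereUniform (2 * D)) = ‖y‖ ^ (2 * k) * sphereCoeff D k := by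
  have hmul : ∀ k : ℕ, (∫ θ, inner ℝ y (θ : EuclideanSpace ℝ (Fin (2 * D))) ^ (2 * k)
        ∂(volume : Measure (EuclideanSpace ℝ (Fin (2 * D)))).toSphere) * (1 / 2) *
        (poch D k * Real.Gamma D) =
      ‖y‖ ^ (2 * k) * (poch (1 / 2) k * Real.Gamma (1 / 2)) * Real.Gamma (1 / 2) ^ (2 * D - 1) := by
    intro k
    obtain ⟨d, hd⟩ : ∃ d, 2 * D = d + 1 := ⟨2 * D - 1, by lia⟩
    have h1 := integral_inner_pow_mul_exp_eq_toSphere (by lia) y (2 * k)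
    have h2 : ∫ x : EuclideanSpace ℝ (Fin (2 * D)), inner ℝ y x ^ (2 * k) * Real.exp (-‖x‖ ^ 2) =
        ‖y‖ ^ (2 * k) * Real.Gamma (k + 1 / 2) * Real.Gamma (1 / 2) ^ (2 * D - 1) := by
      clear h1
      revert y
      rw [hd]
      intro y
      exact integral_inner_pow_mul_exp y k
    have h3 : ((2 * D - 1 + 2 * k : ℕ) + 1 : ℝ) / 2 = D + k := by
      rw [← Nat.cast_succ, show (2 * D - 1 + 2 * k).succ = 2 * (D + k) by lia]
      push_cast
      ring
    rw [h2, integral_Ioi_pow_mul_exp_neg_sq, h3, gamma_add_nat (by positivity), add_comm (k : ℝ),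
      gamma_add_nat (by norm_num)] at h1
    rw [h1]
    ring
  -- The case `k = 0` evaluates the total mass of the sphere, so the ratio with the case `k` removes
  -- the Gamma constants.
  have h0 := hmul 0
  have hk := hmul k
  simp only [mul_zero, pow_zero, poch_zero, one_mul, integral_const, smul_eq_mul, mul_one] at h0
  rw [integral_sphereUniform, sphereCoeff]
  have hG : 0 < Real.Gamma (D : ℝ) := Real.Gamma_pos_of_pos (by positivity)
  have hp : 0 < poch D k := poch_pos (by positivity) k
  have hS : 0 < ((volume : Measure (EuclideanSpace ℝ (Fin (2 * D)))).toSphere Set.univ).toReal := by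
    have : Nonempty (Fin (2 * D)) := ⟨⟨0, by lia⟩⟩
    exact ENNReal.toReal_pos (Measure.measure_univ_ne_zero.2 (Measure.toSphere_ne_zero _))
      (measure_ne_top _ _)
  rw [measureReal_def] at h0
  set S := ((volume : Measure (EuclideanSpace ℝ (Fin (2 * D)))).toSphere Set.univ).toReal
  field_simp
  refine mul_right_cancel₀ hG.ne' ?_
  linear_combination 2 * hk - 2 * ‖y‖ ^ (2 * k) * poch (1 / 2) k * h0

lemma integral_inner_pow_sphereUniform_odd {d : ℕ} (hd : 0 < d) (y : EuclideanSpace ℝ (Fin d))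
    {m : ℕ} (hm : Odd m) : ∫ θ, inner ℝ y θ ^ m ∂(sphereUniform d) = 0 := by
  have h := integral_inner_pow_mul_exp_eq_toSphere hd y m
  rw [integral_inner_pow_mul_exp_odd y hm, integral_Ioi_pow_mul_exp_neg_sq] at h
  have hG : 0 < Real.Gamma (((d - 1 + m : ℕ) + 1 : ℝ) / 2) := Real.Gamma_pos_of_pos (by positivity)
  rw [integral_sphereUniform]
  rcases mul_eq_zero.1 h.symm with h | h
  · rw [h, mul_zero]
  · linarith

open scoped ENNReal

/-! ### The Dirichlet distribution `𝓓(1, …, 1)` -/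

lemma lintegral_pi_prod_eq_prod {E : Type*} [MeasurableSpace E] {n : ℕ} (ν : Measure E)
    [SigmaFinite ν] (f : Fin n → E → ℝ≥0∞) (hf : ∀ i, Measurable (f i)) :
    ∫⁻ x, ∏ i, f i (x i) ∂(Measure.pi fun _ : Fin n => ν) = ∏ i, ∫⁻ x, f i x ∂ν := by
  induction n with
  | zero => simp
  | succ n ih =>
    rw [← ((measurePreserving_piFinSuccAbove (fun _ : Fin (n + 1) => ν) 0).symm).lintegral_comp_emb
      (MeasurableEquiv.measurableEmbedding _)]
    simp only [MeasurableEquiv.piFinSuccAbove_symm_apply, Fin.prod_univ_succ,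
      Fin.insertNthEquiv_apply, Fin.insertNth_zero, Fin.cons_zero, Fin.cons_succ]
    rw [← ih (fun i => f i.succ) (fun i => hf _)]
    exact lintegral_prod_mul (hf 0).aemeasurable
      (Finset.measurable_fun_prod _ fun i _ => (hf _).comp (measurable_pi_apply i)).aemeasurable

lemma pi_withDensity {E : Type*} [MeasurableSpace E] {n : ℕ} (ν : Measure E) [SigmaFinite ν]
    (f : E → ℝ≥0∞) (hf : Measurable f) [SigmaFinite (ν.withDensity f)] :
    (Measure.pi fun _ : Fin n => ν.withDensity f) =
      (Measure.pi fun _ : Fin n => ν).withDensity fun x => ∏ i, f (x i) := by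
  refine Measure.pi_eq fun s hs => ?_
  rw [withDensity_apply _ (MeasurableSet.univ_pi hs), ← lintegral_indicator (MeasurableSet.univ_pi hs)]
  have h := lintegral_pi_prod_eq_prod ν (fun i => (s i).indicator f) fun i => hf.indicator (hs i)
  simp only [lintegral_indicator (hs _)] at h
  simp only [withDensity_apply _ (hs _), ← h]
  refine lintegral_congr fun x => ?_
  by_cases hx : x ∈ Set.univ.pi s
  · rw [Set.indicator_of_mem hx]
    exact Finset.prod_congr rfl fun i _ => (Set.indicator_of_mem (hx i trivial) _).symm
  · rw [Set.indicator_of_notMem hx]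
    simp only [Set.mem_pi, not_forall] at hx
    obtain ⟨i, -, hi⟩ := hx
    exact (Finset.prod_eq_zero (Finset.mem_univ i) (Set.indicator_of_notMem hi _)).symm

/-- Lebesgue measure on the open positive orthant. -/
noncomputable def orthantMeasure (n : ℕ) : Measure (Fin n → ℝ) :=
  Measure.pi fun _ => volume.restrict (Set.Ioi 0)

instance (n : ℕ) : SigmaFinite (orthantMeasure n) := by
  unfold orthantMeasure; infer_instance

lemma orthantMeasure_eq (n : ℕ) :
    orthantMeasure n = volume.restrict (Set.univ.pi fun _ => Set.Ioi 0) := by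
  rw [orthantMeasure, ← Measure.restrict_pi_pi]
  rfl

lemma ae_orthantMeasure_pos (n : ℕ) : ∀ᵐ y ∂(orthantMeasure n), ∀ i, 0 < y i := by
  rw [orthantMeasure_eq]
  filter_upwards [ae_restrict_mem (MeasurableSet.univ_pi fun _ => measurableSet_Ioi)] with y hy i
  exact hy i trivial

lemma lintegral_orthantMeasure_smul {n : ℕ} (F : (Fin n → ℝ) → ℝ≥0∞) {c : ℝ} (hc : 0 < c) :
    ∫⁻ y, F (c⁻¹ • y) ∂(orthantMeasure n) = ENNReal.ofReal (c ^ n) * ∫⁻ y, F y ∂(orthantMeasure n) := by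
  have hmeas : MeasurableSet (Set.univ.pi fun _ => Set.Ioi 0 : Set (Fin n → ℝ)) :=
    MeasurableSet.univ_pi fun _ => measurableSet_Ioi
  have hemb : MeasurableEmbedding fun y : Fin n → ℝ => c⁻¹ • y :=
    (MeasurableEquiv.smul₀ c⁻¹ (inv_ne_zero hc.ne')).measurableEmbedding
  have h := Measure.map_addHaar_smul (volume : Measure (Fin n → ℝ)) (inv_ne_zero hc.ne')
  rw [Module.finrank_fintype_fun_eq_card, Fintype.card_fin, inv_pow, inv_inv,
    abs_of_pos (by positivity)] at h
  rw [orthantMeasure_eq, ← lintegral_indicator hmeas, ← lintegral_indicator hmeas,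
    ← smul_eq_mul, ← lintegral_smul_measure, ← h, hemb.lintegral_map]
  refine lintegral_congr fun y => ?_
  have hiff : c⁻¹ • y ∈ (Set.univ.pi fun _ => Set.Ioi 0 : Set (Fin n → ℝ)) ↔
      y ∈ (Set.univ.pi fun _ => Set.Ioi 0 : Set (Fin n → ℝ)) := by
    simp [Set.mem_pi, mul_pos_iff_of_pos_left (inv_pos.2 hc)]
  by_cases hy : y ∈ (Set.univ.pi fun _ => Set.Ioi 0 : Set (Fin n → ℝ))
  · rw [Set.indicator_of_mem hy, Set.indicator_of_mem (hiff.2 hy)]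
  · rw [Set.indicator_of_notMem hy, Set.indicator_of_notMem (mt hiff.1 hy)]

lemma gammaMeasure_one_one :
    gammaMeasure 1 1 = (volume.restrict (Set.Ioi 0)).withDensity
      fun x : ℝ => ENNReal.ofReal (Real.exp (-x)) := by
  rw [gammaMeasure, ← withDensity_indicator measurableSet_Ioi]
  refine withDensity_congr_ae ?_
  have h0 : ∀ᵐ x : ℝ, x ≠ 0 := by simp [ae_iff]
  filter_upwards [h0] with x hx
  rcases lt_or_gt_of_ne hx with h | h
  · rw [gammaPDF_of_neg h, Set.indicator_of_notMem (by simpa using h.le)]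
  · rw [gammaPDF_of_nonneg h.le, Set.indicator_of_mem (by simpa using h)]
    simp

lemma pi_gammaMeasure_one_one (n : ℕ) :
    (Measure.pi fun _ : Fin n => gammaMeasure 1 1) = (orthantMeasure n).withDensity
      fun y => ENNReal.ofReal (Real.exp (-∑ i, y i)) := by
  have : SigmaFinite ((volume.restrict (Set.Ioi 0)).withDensity
      fun x : ℝ => ENNReal.ofReal (Real.exp (-x))) := by
    have := isProbabilityMeasure_gammaMeasure one_pos one_pos
    rw [← gammaMeasure_one_one]
    infer_instance
  simp only [gammaMeasure_one_one]
  rw [pi_withDensity _ _ (by fun_prop), orthantMeasure]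
  congr 1
  funext y
  rw [← ENNReal.ofReal_prod_of_nonneg fun i _ => (Real.exp_pos _).le, ← Real.exp_sum,
    Finset.sum_neg_distrib]

lemma lintegral_Ioi_pow_mul_exp {n : ℕ} {r : ℝ} (hr : 0 < r) :
    ∫⁻ x in Set.Ioi (0 : ℝ), ENNReal.ofReal (x ^ n * Real.exp (-(r * x))) =
      ENNReal.ofReal ((n ! : ℝ) / r ^ (n + 1)) := by
  have h := Real.integral_rpow_mul_exp_neg_mul_Ioi (show (0 : ℝ) < n + 1 by positivity) hr
  simp only [add_sub_cancel_right, Real.rpow_natCast, Real.Gamma_nat_eq_factorial] at h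
  rw [show ((n : ℝ) + 1) = ((n + 1 : ℕ) : ℝ) by push_cast; ring, Real.rpow_natCast, one_div,
    inv_pow, inv_mul_eq_div] at h
  rw [← h, ofReal_integral_eq_lintegral_ofReal]
  · exact Integrable.of_integral_ne_zero (by rw [h]; positivity)
  · filter_upwards [ae_restrict_mem measurableSet_Ioi] with x hx
    have hx' : (0 : ℝ) < x := hx
    simp only [Pi.zero_apply]
    positivity

lemma lintegral_Ioi_inv_pow_mul_exp {n : ℕ} {r : ℝ} (hr : 0 < r) :
    ∫⁻ x in Set.Ioi (0 : ℝ), ENNReal.ofReal (x⁻¹ ^ (n + 2) * Real.exp (-(r * x⁻¹))) =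
      ENNReal.ofReal ((n ! : ℝ) / r ^ (n + 1)) := by
  rw [← lintegral_Ioi_pow_mul_exp hr]
  have himg : (fun x : ℝ => x⁻¹) '' Set.Ioi 0 = Set.Ioi 0 := by
    ext x
    constructor
    · rintro ⟨y, hy, rfl⟩
      exact Set.mem_Ioi.2 (inv_pos.2 (Set.mem_Ioi.1 hy))
    · exact fun hx => ⟨x⁻¹, Set.mem_Ioi.2 (inv_pos.2 (Set.mem_Ioi.1 hx)), inv_inv x⟩
  have h := lintegral_image_eq_lintegral_abs_deriv_mul (f := fun x : ℝ => x⁻¹)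
    (f' := fun x => -(x ^ 2)⁻¹) (measurableSet_Ioi (a := (0 : ℝ)))
    (fun x hx => (hasDerivAt_inv (ne_of_gt hx)).hasDerivWithinAt) inv_injective.injOn
    (fun x => ENNReal.ofReal (x ^ n * Real.exp (-(r * x))))
  rw [himg] at h
  rw [h]
  refine setLIntegral_congr_fun measurableSet_Ioi fun x hx => ?_
  have hx' : (0 : ℝ) < x := hx
  rw [← ENNReal.ofReal_mul (abs_nonneg _), abs_neg, abs_of_pos (by positivity), pow_add, inv_pow x 2]
  congr 1
  ring

/-- For `S = ∑ yᵢ` and `G = ∑ (1 + aᵢ) yᵢ`, the left side is a Dirichlet expectation, as `S / G`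
depends only on `y / S`, and the right side is a product of one-dimensional integrals. After
multiplication by `n!`, expand `n! / G^(n+1)` on the left as an integral in `t`, and insert `n! =
S^(n+1) ∫ t^(-n-2) e^(-S/t) dt` on the right. For fixed `t` the scaling `y ↦ t⁻¹ y` matches the two
integrands. -/
lemma lintegral_orthantMeasure_exp_mul_div_pow {n : ℕ} (S G : (Fin (n + 1) → ℝ) → ℝ)
    (hSm : Measurable S) (hGm : Measurable G)
    (hS : ∀ (c : ℝ) y, S (c • y) = c * S y) (hG : ∀ (c : ℝ) y, G (c • y) = c * G y)
    (hSpos : ∀ y, (∀ i, 0 < y i) → 0 < S y) (hGpos : ∀ y, (∀ i, 0 < y i) → 0 < G y) :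
    ∫⁻ y, ENNReal.ofReal (Real.exp (-S y) * (S y / G y) ^ (n + 1)) ∂(orthantMeasure (n + 1)) =
      ∫⁻ y, ENNReal.ofReal (Real.exp (-G y)) ∂(orthantMeasure (n + 1)) := by
  have hfac : ENNReal.ofReal (n ! : ℝ) ≠ 0 := by
    rw [Ne, ENNReal.ofReal_eq_zero, not_le]; positivity
  refine (ENNReal.mul_right_inj hfac ENNReal.ofReal_ne_top).1 ?_
  rw [← lintegral_const_mul _ (by fun_prop), ← lintegral_const_mul _ (by fun_prop)]
  have h1 : ∫⁻ y, ENNReal.ofReal (n ! : ℝ) *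
        ENNReal.ofReal (Real.exp (-S y) * (S y / G y) ^ (n + 1)) ∂(orthantMeasure (n + 1)) =
      ∫⁻ y, (∫⁻ t in Set.Ioi (0 : ℝ), ENNReal.ofReal (Real.exp (-S y) * S y ^ (n + 1)) *
        ENNReal.ofReal (t ^ n * Real.exp (-(G y * t)))) ∂(orthantMeasure (n + 1)) := by
    refine lintegral_congr_ae ?_
    filter_upwards [ae_orthantMeasure_pos (n + 1)] with y hy
    have hs := hSpos y hy
    rw [lintegral_const_mul _ (by fun_prop), lintegral_Ioi_pow_mul_exp (hGpos y hy),
      ← ENNReal.ofReal_mul (by positivity), ← ENNReal.ofReal_mul (by positivity)]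
    congr 1
    rw [div_pow]
    ring
  have h2 : ∫⁻ y, ENNReal.ofReal (n ! : ℝ) *
        ENNReal.ofReal (Real.exp (-G y)) ∂(orthantMeasure (n + 1)) =
      ∫⁻ y, (∫⁻ t in Set.Ioi (0 : ℝ), ENNReal.ofReal (Real.exp (-G y) * S y ^ (n + 1)) *
        ENNReal.ofReal (t⁻¹ ^ (n + 2) * Real.exp (-(S y * t⁻¹)))) ∂(orthantMeasure (n + 1)) := by
    refine lintegral_congr_ae ?_
    filter_upwards [ae_orthantMeasure_pos (n + 1)] with y hy
    have hs := hSpos y hy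
    rw [lintegral_const_mul _ (by fun_prop), lintegral_Ioi_inv_pow_mul_exp hs,
      ← ENNReal.ofReal_mul (by positivity), ← ENNReal.ofReal_mul (by positivity)]
    congr 1
    field_simp
  rw [h1.trans (lintegral_lintegral_swap (by fun_prop)),
    h2.trans (lintegral_lintegral_swap (by fun_prop))]
  refine setLIntegral_congr_fun (measurableSet_Ioi (a := (0 : ℝ))) fun t ht => ?_
  have ht' : (0 : ℝ) < t := ht
  have h3 := lintegral_orthantMeasure_smul (n := n + 1) (fun y =>
    ENNReal.ofReal (Real.exp (-S y) * S y ^ (n + 1)) *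
        ENNReal.ofReal (t ^ n * Real.exp (-(G y * t)))) ht'
  have htn : ENNReal.ofReal (t ^ (n + 1)) ≠ 0 := by
    rw [Ne, ENNReal.ofReal_eq_zero, not_le]; positivity
  refine (ENNReal.mul_right_inj htn ENNReal.ofReal_ne_top).1 ?_
  rw [← h3, ← lintegral_const_mul _ (by fun_prop)]
  refine lintegral_congr_ae ?_
  filter_upwards [ae_orthantMeasure_pos (n + 1)] with y hy
  have hs := hSpos y hy
  have hs' : 0 < S (t⁻¹ • y) := by rw [hS]; positivity
  rw [← ENNReal.ofReal_mul (by positivity), ← ENNReal.ofReal_mul (by positivity),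
    ← ENNReal.ofReal_mul (by positivity), hS, hG]
  congr 1
  rw [show t⁻¹ * G y * t = G y by field_simp, mul_pow, pow_add _ n 2, pow_succ (t⁻¹) n, inv_pow,
    mul_comm t⁻¹ (S y)]
  field_simp
  ring

lemma lintegral_orthantMeasure_exp_neg_sum {n : ℕ} (b : Fin n → ℝ) (hb : ∀ i, 0 < b i) :
    ∫⁻ y, ENNReal.ofReal (Real.exp (-∑ i, b i * y i)) ∂(orthantMeasure n) =
      ENNReal.ofReal (∏ i, 1 / b i) := by
  have h := lintegral_pi_prod_eq_prod (volume.restrict (Set.Ioi (0 : ℝ)))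
    (fun i x => ENNReal.ofReal (Real.exp (-(b i * x)))) fun i => by fun_prop
  have h1 : ∀ i, ∫⁻ x in Set.Ioi (0 : ℝ), ENNReal.ofReal (Real.exp (-(b i * x))) =
      ENNReal.ofReal (1 / b i) := by
    intro i
    simpa using lintegral_Ioi_pow_mul_exp (n := 0) (hb i)
  simp only [h1] at h
  rw [ENNReal.ofReal_prod_of_nonneg fun i _ => (one_div_pos.2 (hb i)).le, ← h, orthantMeasure]
  refine lintegral_congr fun y => ?_
  rw [← ENNReal.ofReal_prod_of_nonneg fun i _ => (Real.exp_pos _).le, ← Real.exp_sum,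
    Finset.sum_neg_distrib]

lemma measurable_normalize (n : ℕ) : Measurable fun (y : Fin n → ℝ) i => y i / ∑ j, y j := by
  fun_prop

lemma ae_dirichletMeasure_one (n : ℕ) (hn : 1 ≤ n) :
    ∀ᵐ x ∂(dirichletMeasure fun _ : Fin n => 1), (∀ i, 0 < x i) ∧ ∑ i, x i = 1 := by
  have hmeas : MeasurableSet {x : Fin n → ℝ | (∀ i, 0 < x i) ∧ ∑ i, x i = 1} := by
    have h : {x : Fin n → ℝ | ∀ i, 0 < x i} = Set.univ.pi fun _ => Set.Ioi 0 := by
      ext x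
      simp
    refine MeasurableSet.inter ?_ (measurableSet_eq_fun (by fun_prop) (by fun_prop))
    change MeasurableSet {x : Fin n → ℝ | ∀ i, 0 < x i}
    rw [h]
    exact MeasurableSet.univ_pi fun _ => measurableSet_Ioi
  rw [dirichletMeasure, ae_map_iff (measurable_normalize n).aemeasurable hmeas,
    pi_gammaMeasure_one_one]
  refine (withDensity_absolutelyContinuous _ _).ae_le ?_
  filter_upwards [ae_orthantMeasure_pos n] with y hy
  have : Nonempty (Fin n) := ⟨⟨0, hn⟩⟩
  have hS : 0 < ∑ j, y j := Finset.sum_pos (fun i _ => hy i) Finset.univ_nonempty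
  refine ⟨fun i => div_pos (hy i) hS, ?_⟩
  rw [← Finset.sum_div, div_self hS.ne']

lemma isProbabilityMeasure_dirichletMeasure_one (n : ℕ) :
    IsProbabilityMeasure (dirichletMeasure fun _ : Fin n => 1) := by
  have := isProbabilityMeasure_gammaMeasure one_pos one_pos
  exact Measure.isProbabilityMeasure_map (measurable_normalize n).aemeasurable

/-- `𝔼 (1 + ∑ Xⱼ aⱼ)⁻ⁿ = ∏ (1 + aⱼ)⁻¹` for `X ∼ 𝓓(1, …, 1)`. -/
lemma integral_dirichletMeasure_one_div_pow (n : ℕ) (hn : 1 ≤ n) (a : Fin n → ℝ)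
    (ha : ∀ i, -1 < a i) :
    ∫ x, 1 / (1 + ∑ i, x i * a i) ^ n ∂(dirichletMeasure fun _ : Fin n => 1) =
      ∏ i, 1 / (1 + a i) := by
  obtain ⟨n, rfl⟩ : ∃ m, n = m + 1 := ⟨n - 1, by lia⟩
  have hb : ∀ i, 0 < 1 + a i := fun i => by linarith [ha i]
  have hpos : ∀ x : Fin (n + 1) → ℝ, (∀ i, 0 < x i) → 0 < ∑ i, x i := fun x hx =>
    Finset.sum_pos (fun i _ => hx i) Finset.univ_nonempty
  have hpos' : ∀ x : Fin (n + 1) → ℝ, (∀ i, 0 < x i) → 0 < ∑ i, (1 + a i) * x i := fun x hx =>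
    Finset.sum_pos (fun i _ => mul_pos (hb i) (hx i)) Finset.univ_nonempty
  have hsum : ∀ x : Fin (n + 1) → ℝ, ∑ i, x i + ∑ i, x i * a i = ∑ i, (1 + a i) * x i := by
    intro x
    rw [← Finset.sum_add_distrib]
    exact Finset.sum_congr rfl fun i _ => by ring
  rw [integral_eq_lintegral_of_nonneg_ae]
  · have h := lintegral_orthantMeasure_exp_mul_div_pow (fun y : Fin (n + 1) → ℝ => ∑ i, y i)
      (fun y => ∑ i, (1 + a i) * y i) (by fun_prop) (by fun_prop)
      (fun c y => by simp [Finset.mul_sum])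
      (fun c y => by
        rw [Finset.mul_sum]
        exact Finset.sum_congr rfl fun i _ => by simp; ring) hpos hpos'
    rw [lintegral_orthantMeasure_exp_neg_sum _ hb] at h
    rw [dirichletMeasure, lintegral_map (by fun_prop) (measurable_normalize _),
      pi_gammaMeasure_one_one, lintegral_withDensity_eq_lintegral_mul _ (by fun_prop) (by fun_prop),
      ← ENNReal.toReal_ofReal (Finset.prod_nonneg fun i _ => (one_div_pos.2 (hb i)).le), ← h]
    congr 1
    refine lintegral_congr_ae ?_
    filter_upwards [ae_orthantMeasure_pos (n + 1)] with y hy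
    have hS := hpos y hy
    have hG := hpos' y hy
    simp only [Pi.mul_apply]
    rw [← ENNReal.ofReal_mul (Real.exp_pos _).le]
    congr 2
    -- At the normalised point `y / S`, the quantity `1 + ∑ xᵢ aᵢ` equals `G / S`.
    have h1 : ∑ i, y i / (∑ j, y j) * a i = (∑ i, y i * a i) / ∑ j, y j := by
      rw [Finset.sum_div]
      exact Finset.sum_congr rfl fun i _ => by ring
    rw [h1, show 1 + (∑ i, y i * a i) / ∑ j, y j = (∑ i, (1 + a i) * y i) / ∑ j, y j by
      rw [← hsum y]; field_simp, div_pow, div_pow, one_div_div]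
  · filter_upwards [ae_dirichletMeasure_one (n + 1) hn] with x hx
    have h1 := hsum x
    rw [hx.2] at h1
    have h2 := hpos' x hx.1
    rw [← h1] at h2
    simp only [Pi.zero_apply]
    positivity
  · exact Measurable.aestronglyMeasurable (by fun_prop)

/-! ### Power series -/

lemma eq_zero_of_hasSum_pow_eq_zero {c : ℕ → ℝ}
    (h : ∀ t : ℝ, |t| < 1 → HasSum (fun m => c m * t ^ m) 0) : c = 0 := by
  have hp : HasFPowerSeriesAt (fun _ : ℝ => (0 : ℝ)) (FormalMultilinearSeries.ofScalars ℝ c) 0 := by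
    rw [hasFPowerSeriesAt_iff]
    filter_upwards [Metric.ball_mem_nhds (0 : ℝ) one_pos] with t ht
    rw [mem_ball_zero_iff, Real.norm_eq_abs] at ht
    simpa [FormalMultilinearSeries.coeff_ofScalars, mul_comm] using h t ht
  have h0 := hp.eq_zero
  funext m
  exact congrFun (((FormalMultilinearSeries.ofScalars_series_eq_zero ℝ).1 h0 : c = 0)) m

lemma hasSum_iff_even {f : ℕ → ℝ} {s : ℝ} (hf : ∀ m, Odd m → f m = 0) :
    HasSum (fun k => f (2 * k)) s ↔ HasSum f s := by
  refine Function.Injective.hasSum_iff (g := fun k : ℕ => 2 * k)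
    (fun a b hab => by simpa using hab) fun m hm => hf m ?_
  rw [← Nat.not_even_iff_odd]
  rintro ⟨k, rfl⟩
  exact hm ⟨k, by simp; ring⟩

section BoundedVariable

variable {Ω : Type*} [MeasurableSpace Ω] {P : Measure Ω} [IsProbabilityMeasure P] {V : Ω → ℝ}

lemma integrable_pow_of_abs_le_one (hV : AEMeasurable V P) (h : ∀ᵐ ω ∂P, |V ω| ≤ 1) (m : ℕ) :
    Integrable (fun ω => V ω ^ m) P := by
  refine Integrable.of_bound (hV.pow_const m).aestronglyMeasurable 1 ?_
  filter_upwards [h] with ω hω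
  rw [Real.norm_eq_abs, abs_pow]
  exact pow_le_one₀ (abs_nonneg _) hω

lemma integrable_one_div_one_add_pow (hV : AEMeasurable V P) {r : ℝ} (hr : r < 1)
    (h : ∀ᵐ ω ∂P, |V ω| ≤ r) (n : ℕ) : Integrable (fun ω => 1 / (1 + V ω) ^ n) P := by
  refine Integrable.of_bound (C := 1 / (1 - r) ^ n)
    (AEMeasurable.aestronglyMeasurable (by fun_prop)) ?_
  filter_upwards [h] with ω hω
  have h1 := (abs_le.1 hω).1
  have h2 : 0 < 1 - r := by linarith
  have h3 : 0 < 1 + V ω := by linarith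
  rw [Real.norm_eq_abs, abs_of_pos (by positivity)]
  gcongr
  linarith

/-- The negative binomial series integrated term by term; the bound `r < 1` supplies the dominating
series. -/
lemma hasSum_integral_one_div_one_add_pow (hV : AEMeasurable V P) {r : ℝ} (hr0 : 0 ≤ r)
    (hr : r < 1) (h : ∀ᵐ ω ∂P, |V ω| ≤ r) (n : ℕ) :
    HasSum (fun m => ((m + n).choose n : ℝ) * (-1) ^ m * ∫ ω, V ω ^ m ∂P)
      (∫ ω, 1 / (1 + V ω) ^ (n + 1) ∂P) := by
  have hs : Summable fun m => ((m + n).choose n : ℝ) * r ^ m :=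
    summable_choose_mul_geometric_of_norm_lt_one n (by rwa [Real.norm_eq_abs, abs_of_nonneg hr0])
  simp only [← integral_const_mul]
  refine hasSum_integral_of_dominated_convergence (fun m _ => ((m + n).choose n : ℝ) * r ^ m)
    (fun m => ((hV.pow_const m).const_mul _).aestronglyMeasurable) (fun m => ?_)
    (ae_of_all _ fun _ => hs) (integrable_const _) ?_
  · filter_upwards [h] with ω hω
    rw [Real.norm_eq_abs, abs_mul, abs_mul, abs_pow, abs_pow, abs_neg, abs_one, one_pow, mul_one,
      Nat.abs_cast]
    gcongr
  · filter_upwards [h] with ω hω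
    have h1 := hasSum_choose_mul_geometric_of_norm_lt_one n (r := -V ω)
      (by rw [norm_neg, Real.norm_eq_abs]; linarith)
    rw [sub_neg_eq_add] at h1
    simpa only [neg_pow (V ω), ← mul_assoc] using h1

end BoundedVariable

/-- The parameter `u ∈ [0, 1/2)` with `4u - 4u² = t²`, for `|t| < 1`. -/
lemma exists_parameter {t : ℝ} (ht : |t| < 1) :
    ∃ u : ℝ, 0 ≤ u ∧ u < 1 / 2 ∧ 4 * u - 4 * u ^ 2 = t ^ 2 := by
  have h1 : t ^ 2 < 1 := by rwa [sq_lt_one_iff_abs_lt_one]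
  have h2 : 0 < √(1 - t ^ 2) := Real.sqrt_pos.2 (by linarith)
  have h3 : √(1 - t ^ 2) ≤ 1 := Real.sqrt_le_one.2 (by nlinarith)
  have h4 : √(1 - t ^ 2) ^ 2 = 1 - t ^ 2 := Real.sq_sqrt (by linarith)
  exact ⟨(1 - √(1 - t ^ 2)) / 2, by linarith, by linarith, by linarith⟩

lemma ae_abs_inner_le_sphereUniform {d : ℕ} (y : EuclideanSpace ℝ (Fin d)) :
    ∀ᵐ θ ∂(sphereUniform d), |inner ℝ y θ| ≤ ‖y‖ := by
  filter_upwards [ae_norm_eq_one_sphereUniform d] with θ hθ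
  simpa [hθ] using abs_real_inner_le_norm y θ

lemma integral_one_div_sphereUniform {D : ℕ} (hD : 2 ≤ D) (y : EuclideanSpace ℝ (Fin (2 * D)))
    (hy : ‖y‖ < 1) {u : ℝ} (h0 : 0 ≤ u) (h1 : u < 1 / 2) (hu : 4 * u - 4 * u ^ 2 = ‖y‖ ^ 2) :
    ∫ θ, 1 / (1 + inner ℝ y θ) ∂(sphereUniform (2 * D)) = (generatingB D).eval (1 - u)⁻¹ := by
  have := isProbabilityMeasure_sphereUniform (show 0 < 2 * D by lia)
  have h := hasSum_integral_one_div_one_add_pow (P := sphereUniform (2 * D))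
    (V := fun θ => inner ℝ y θ) (by fun_prop) (norm_nonneg y) hy
    (ae_abs_inner_le_sphereUniform y) 0
  rw [← hasSum_iff_even fun m hm => by
    rw [integral_inner_pow_sphereUniform_odd (by lia) y hm, mul_zero]] at h
  simp only [integral_inner_pow_sphereUniform (show 1 ≤ D by lia), zero_add, pow_one,
    Nat.choose_zero_right, Nat.cast_one, one_mul, (even_two_mul _).neg_one_pow] at h
  refine h.unique ?_
  have h' := hasSum_sphereCoeff D hD h0 h1
  rw [hu] at h'
  simpa only [pow_mul, mul_comm (sphereCoeff _ _)] using h'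

/-! ### The powers of `∑ B_k z^k` -/

lemma coeffP_eq (D n i : ℕ) : coeffP D n i = (generatingB D ^ n).coeff i := rfl

lemma eval_generatingB_pow (D n : ℕ) (z : ℝ) :
    (generatingB D).eval z ^ n = ∑ i ∈ Finset.Icc n (n * (D - 1)), coeffP D n i * z ^ i := by
  have hdeg : (generatingB D).natDegree ≤ D - 1 := by
    refine natDegree_sum_le_of_forall_le _ _ fun k hk => ?_
    exact (natDegree_C_mul_X_pow_le _ _).trans (Finset.mem_Icc.1 hk).2
  have hdeg' : (generatingB D ^ n).natDegree < n * (D - 1) + 1 :=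
    Nat.lt_succ_of_le (natDegree_pow_le.trans (Nat.mul_le_mul_left n hdeg))
  -- `∑ B_k z^k` has no constant term, which is why the sum starts at `i = n`.
  have hdvd : X ^ n ∣ generatingB D ^ n := by
    refine pow_dvd_pow_of_dvd (Finset.dvd_sum fun k hk => ?_) n
    exact (dvd_pow_self X (by have := (Finset.mem_Icc.1 hk).1; lia)).mul_left _
  rw [← eval_pow, eval_eq_sum_range' hdeg']
  symm
  simp only [coeffP_eq]
  refine Finset.sum_subset (fun i hi => ?_) fun i _ hi => ?_
  · simp only [Finset.mem_Icc, Finset.mem_range] at hi ⊢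
    lia
  · simp only [Finset.mem_Icc, Finset.mem_range, not_and_or, not_le] at *
    rw [X_pow_dvd_iff.1 hdvd i (by lia), zero_mul]

lemma sum_coeffP (D n : ℕ) (hD : 2 ≤ D) :
    ∑ i ∈ Finset.Icc n (n * (D - 1)), coeffP D n i = 1 := by
  have h := eval_generatingB_pow D n 1
  rw [generatingB_eval_one D hD] at h
  simpa using h.symm

/-! ### The Dirichlet random walk -/

section Walk

variable {Ω : Type*} [MeasurableSpace Ω] {P : Measure Ω} {D n : ℕ}
  {X : Ω → Fin n → ℝ} {Θ : Fin n → Ω → EuclideanSpace ℝ (Fin (2 * D))}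

lemma IsDirichletWalk.aemeasurable_walk (hW : IsDirichletWalk P (fun _ => 1) X Θ) :
    AEMeasurable (walk X Θ) P := by
  have h1 := hW.hasLaw_weights.aemeasurable
  have h2 := fun j => (hW.hasLaw_direction j).aemeasurable
  unfold walk
  refine Finset.aemeasurable_fun_sum _ fun j _ => ?_
  exact ((measurable_pi_apply j).comp_aemeasurable h1).smul (h2 j)

lemma IsDirichletWalk.ae_weights (hn : 1 ≤ n) (hW : IsDirichletWalk P (fun _ => 1) X Θ) :
    ∀ᵐ ω ∂P, (∀ i, 0 < X ω i) ∧ ∑ i, X ω i = 1 := by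
  have h := ae_dirichletMeasure_one n hn
  rw [← hW.hasLaw_weights.map_eq] at h
  exact ae_of_ae_map hW.hasLaw_weights.aemeasurable h

lemma IsDirichletWalk.ae_norm_direction (hW : IsDirichletWalk P (fun _ => 1) X Θ) :
    ∀ᵐ ω ∂P, ∀ j, ‖Θ j ω‖ = 1 := by
  rw [ae_all_iff]
  intro j
  have h := ae_norm_eq_one_sphereUniform (2 * D)
  rw [← (hW.hasLaw_direction j).map_eq] at h
  exact ae_of_ae_map (hW.hasLaw_direction j).aemeasurable h

lemma IsDirichletWalk.ae_norm_walk_le (hn : 1 ≤ n) (hW : IsDirichletWalk P (fun _ => 1) X Θ) :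
    ∀ᵐ ω ∂P, ‖walk X Θ ω‖ ≤ 1 := by
  filter_upwards [hW.ae_weights hn, hW.ae_norm_direction] with ω h1 h2
  refine (norm_sum_le _ _).trans ?_
  rw [← h1.2]
  refine Finset.sum_le_sum fun j _ => ?_
  rw [norm_smul, h2 j, mul_one, Real.norm_eq_abs, abs_of_pos (h1.1 j)]

lemma IsDirichletWalk.ae_abs_inner_walk_le (hn : 1 ≤ n)
    (hW : IsDirichletWalk P (fun _ => 1) X Θ) (y : EuclideanSpace ℝ (Fin (2 * D))) :
    ∀ᵐ ω ∂P, |inner ℝ y (walk X Θ ω)| ≤ ‖y‖ := by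
  filter_upwards [hW.ae_norm_walk_le hn] with ω hω
  exact (abs_real_inner_le_norm _ _).trans (mul_le_of_le_one_right (norm_nonneg _) hω)

variable [IsProbabilityMeasure P]

lemma IsDirichletWalk.hasLaw_prod (hW : IsDirichletWalk P (fun _ => 1) X Θ) :
    HasLaw (fun ω => (X ω, fun j => Θ j ω))
      ((dirichletMeasure fun _ => 1).prod (Measure.pi fun _ => sphereUniform (2 * D))) P :=
  IndepFun.hasLaw_prod hW.hasLaw_weights
    (hW.iIndepFun_direction.hasLaw_pi hW.hasLaw_direction) hW.indepFun

/-- `T_n(W) = T_1(Θ)ⁿ`. -/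
lemma IsDirichletWalk.integral_one_div_pow (hD : 1 ≤ D) (hn : 1 ≤ n)
    (hW : IsDirichletWalk P (fun _ => 1) X Θ) (y : EuclideanSpace ℝ (Fin (2 * D)))
    (hy : ‖y‖ < 1) :
    ∫ ω, 1 / (1 + inner ℝ y (walk X Θ ω)) ^ n ∂P =
      (∫ θ, 1 / (1 + inner ℝ y θ) ∂(sphereUniform (2 * D))) ^ n := by
  have hprob := isProbabilityMeasure_sphereUniform (show 0 < 2 * D by lia)
  have hprob' := isProbabilityMeasure_dirichletMeasure_one n
  set F : (Fin n → ℝ) × (Fin n → EuclideanSpace ℝ (Fin (2 * D))) → ℝ :=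
    fun p => 1 / (1 + ∑ i, p.1 i * inner ℝ y (p.2 i)) ^ n with hF
  have hFm : Measurable F := by fun_prop
  have hinner : ∀ ω, 1 / (1 + inner ℝ y (walk X Θ ω)) ^ n = F (X ω, fun j => Θ j ω) := by
    intro ω
    simp only [hF, walk, inner_sum, real_inner_smul_right]
  have hlaw := hW.hasLaw_prod
  have hint : Integrable F
      ((dirichletMeasure fun _ => 1).prod (Measure.pi fun _ => sphereUniform (2 * D))) := by
    have h := integrable_one_div_one_add_pow (V := fun ω => inner ℝ y (walk X Θ ω)) (P := P)
      (hW.aemeasurable_walk.const_inner) hy (hW.ae_abs_inner_walk_le hn y) n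
    simp only [hinner] at h
    rw [← hlaw.map_eq, integrable_map_measure hFm.aestronglyMeasurable hlaw.aemeasurable]
    exact h
  simp only [hinner]
  rw [show ∫ ω, F (X ω, fun j => Θ j ω) ∂P = _ from hlaw.integral_comp hFm.aestronglyMeasurable,
    integral_prod_symm _ hint]
  -- With the directions frozen, the Dirichlet identity applies with `aᵢ = ⟨y, θᵢ⟩ > -1`; its
  -- product form then factors over the independent directions.
  have hae : ∀ᵐ θ ∂(Measure.pi fun _ : Fin n => sphereUniform (2 * D)),
      ∫ x, F (x, θ) ∂(dirichletMeasure fun _ => 1) = ∏ i, 1 / (1 + inner ℝ y (θ i)) := by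
    have h : ∀ᵐ θ ∂(Measure.pi fun _ : Fin n => sphereUniform (2 * D)),
        ∀ i, |inner ℝ y (θ i)| ≤ ‖y‖ := by
      rw [ae_all_iff]
      have hσ : SigmaFinite (sphereUniform (2 * D)) := IsFiniteMeasure.toSigmaFinite _
      exact fun i => (Measure.quasiMeasurePreserving_eval
        (fun _ : Fin n => sphereUniform (2 * D)) i).ae (ae_abs_inner_le_sphereUniform y)
    filter_upwards [h] with θ hθ
    exact integral_dirichletMeasure_one_div_pow n hn (fun i => inner ℝ y (θ i)) fun i => by
      linarith [(abs_le.1 (hθ i)).1]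
  rw [integral_congr_ae hae, integral_fintype_prod_eq_prod
    (f := fun _ θ => 1 / (1 + inner ℝ y θ)), Finset.prod_const, Finset.card_univ, Fintype.card_fin]

lemma IsDirichletWalk.integral_one_div_pow_eq_sum (hD : 2 ≤ D) (hn : 1 ≤ n)
    (hW : IsDirichletWalk P (fun _ => 1) X Θ) (y : EuclideanSpace ℝ (Fin (2 * D)))
    (hy : ‖y‖ < 1) {u : ℝ} (h0 : 0 ≤ u) (h1 : u < 1 / 2) (hu : 4 * u - 4 * u ^ 2 = ‖y‖ ^ 2) :
    ∫ ω, 1 / (1 + inner ℝ y (walk X Θ ω)) ^ n ∂P =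
      ∑ i ∈ Finset.Icc n (n * (D - 1)), coeffP D n i * (1 - u)⁻¹ ^ i := by
  rw [hW.integral_one_div_pow (by lia) hn y hy, integral_one_div_sphereUniform hD y hy h0 h1 hu,
    eval_generatingB_pow]

/-- Comparison of the coefficients of `t^(2k)` in two expansions of `T_{n+1}(W)(t e)`. The value
does not depend on the unit vector `e`. -/
lemma IsDirichletWalk.integral_inner_pow (hD : 2 ≤ D) {X : Ω → Fin (n + 1) → ℝ}
    {Θ : Fin (n + 1) → Ω → EuclideanSpace ℝ (Fin (2 * D))}
    (hW : IsDirichletWalk P (fun _ : Fin (n + 1) => 1) X Θ) {e : EuclideanSpace ℝ (Fin (2 * D))}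
    (he : ‖e‖ = 1) (k : ℕ) :
    ((2 * k + n).choose n : ℝ) * ∫ ω, inner ℝ e (walk X Θ ω) ^ (2 * k) ∂P =
      ∑ i ∈ Finset.Icc (n + 1) ((n + 1) * (D - 1)), coeffP D (n + 1) i * ballotCoeff i k := by
  set a : ℕ → ℝ := fun m => if Even m then
    ∑ i ∈ Finset.Icc (n + 1) ((n + 1) * (D - 1)), coeffP D (n + 1) i * ballotCoeff i (m / 2) else 0
    with ha
  set b : ℕ → ℝ := fun m =>
    ((m + n).choose n : ℝ) * (-1) ^ m * ∫ ω, inner ℝ e (walk X Θ ω) ^ m ∂P with hb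
  have h : (fun m => a m - b m) = 0 := by
    refine eq_zero_of_hasSum_pow_eq_zero fun t ht => ?_
    have hnorm : ‖t • e‖ = |t| := by rw [norm_smul, he, mul_one, Real.norm_eq_abs]
    obtain ⟨u, h0, h1, hu⟩ := exists_parameter ht
    have hsa : HasSum (fun m => a m * t ^ m) (∑ i ∈ Finset.Icc (n + 1) ((n + 1) * (D - 1)),
        coeffP D (n + 1) i * (1 - u)⁻¹ ^ i) := by
      rw [← hasSum_iff_even fun m hm => by rw [ha]; simp [Nat.not_even_iff_odd.2 hm]]
      have := hasSum_sum (s := Finset.Icc (n + 1) ((n + 1) * (D - 1)))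
        fun i _ => (hasSum_ballotCoeff i h0 h1).mul_left (coeffP D (n + 1) i)
      rw [hu] at this
      simpa [ha, Finset.sum_mul, mul_assoc, pow_mul] using this
    have hsb : HasSum (fun m => b m * t ^ m)
        (∫ ω, 1 / (1 + inner ℝ (t • e) (walk X Θ ω)) ^ (n + 1) ∂P) := by
      have := hasSum_integral_one_div_one_add_pow (P := P)
        (V := fun ω => inner ℝ (t • e) (walk X Θ ω)) hW.aemeasurable_walk.const_inner
        (norm_nonneg (t • e)) (by rwa [hnorm]) (hW.ae_abs_inner_walk_le (by lia) (t • e)) n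
      simpa only [hb, real_inner_smul_left, mul_pow, integral_const_mul, mul_assoc,
        mul_left_comm (t ^ _), mul_comm (t ^ _) (integral _ _)] using this
    rw [hW.integral_one_div_pow_eq_sum hD (by lia) (t • e) (by rwa [hnorm]) h0 h1
      (by rw [hu, hnorm, sq_abs])] at hsb
    simpa only [sub_mul, sub_self] using hsa.sub hsb
  have h2 := congrFun h (2 * k)
  simp only [ha, hb, Pi.zero_apply, even_two_mul, if_true, (even_two_mul _).neg_one_pow, mul_one]
    at h2
  rw [Nat.mul_div_cancel_left k two_pos] at h2
  linarith

/-- By Fubini, averaging over an auxiliary uniform direction replaces `⟨θ, W⟩` by the radius. -/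
lemma IsDirichletWalk.integral_integral_inner_pow (hD : 1 ≤ D) (hn : 1 ≤ n)
    (hW : IsDirichletWalk P (fun _ : Fin n => 1) X Θ) (k : ℕ) :
    ∫ θ, (∫ ω, inner ℝ θ (walk X Θ ω) ^ (2 * k) ∂P) ∂(sphereUniform (2 * D)) =
      (∫ ω, ‖walk X Θ ω‖ ^ (2 * k) ∂P) * sphereCoeff D k := by
  have hprob := isProbabilityMeasure_sphereUniform (show 0 < 2 * D by lia)
  rw [integral_integral_swap]
  · simp only [real_inner_comm (walk X Θ _)]
    simp only [integral_inner_pow_sphereUniform hD, integral_mul_const]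
  · have hm := hW.aemeasurable_walk
    refine integrable_pow_of_abs_le_one (V := fun p : EuclideanSpace ℝ (Fin (2 * D)) × Ω =>
      inner ℝ p.1 (walk X Θ p.2)) ?_ ?_ (2 * k)
    · exact measurable_fst.aemeasurable.inner hm.comp_snd
    · filter_upwards [Measure.quasiMeasurePreserving_fst.ae (ae_norm_eq_one_sphereUniform (2 * D)),
        Measure.quasiMeasurePreserving_snd.ae (hW.ae_norm_walk_le hn)] with p h1 h2
      refine (abs_real_inner_le_norm _ _).trans ?_
      rw [h1, one_mul]
      exact h2

lemma IsDirichletWalk.integral_norm_pow (hD : 2 ≤ D) (hn : 1 ≤ n)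
    (hW : IsDirichletWalk P (fun _ : Fin n => 1) X Θ) (k : ℕ) :
    ∫ ω, ‖walk X Θ ω‖ ^ (2 * k) ∂P = poch D k / poch n (2 * k) *
      ∑ i ∈ Finset.Icc n (n * (D - 1)), coeffP D n i *
        (poch i (2 * k) / poch ((i : ℝ) + 1) k) := by
  obtain ⟨n, rfl⟩ : ∃ m, n = m + 1 := ⟨n - 1, by lia⟩
  have hprob := isProbabilityMeasure_sphereUniform (show 0 < 2 * D by lia)
  have h1 := hW.integral_integral_inner_pow (by lia) hn k
  have h2 : ∫ θ, ((2 * k + n).choose n : ℝ) * (∫ ω, inner ℝ θ (walk X Θ ω) ^ (2 * k) ∂P)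
        ∂(sphereUniform (2 * D)) =
      ∑ i ∈ Finset.Icc (n + 1) ((n + 1) * (D - 1)), coeffP D (n + 1) i * ballotCoeff i k := by
    rw [integral_congr_ae (g := fun _ =>
      ∑ i ∈ Finset.Icc (n + 1) ((n + 1) * (D - 1)), coeffP D (n + 1) i * ballotCoeff i k)]
    · simp
    · filter_upwards [ae_norm_eq_one_sphereUniform (2 * D)] with θ hθ
      exact hW.integral_inner_pow hD hθ k
  rw [integral_const_mul, h1] at h2
  have h3 : ∑ i ∈ Finset.Icc (n + 1) ((n + 1) * (D - 1)), coeffP D (n + 1) i * ballotCoeff i k =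
      (∑ i ∈ Finset.Icc (n + 1) ((n + 1) * (D - 1)), coeffP D (n + 1) i *
        (poch i (2 * k) / poch ((i : ℝ) + 1) k)) / (4 ^ k * (k ! : ℝ)) := by
    rw [Finset.sum_div]
    refine Finset.sum_congr rfl fun i _ => ?_
    rw [ballotCoeff, mul_div_assoc, div_div, mul_comm (poch ((i : ℝ) + 1) k)]
  rw [h3] at h2
  have h4 : poch ((n + 1 : ℕ) : ℝ) (2 * k) = ((2 * k + n).choose n : ℝ) * ((2 * k)! : ℝ) := by
    rw [Nat.cast_succ, poch_natCast_succ, add_comm (2 * k), Nat.cast_add_choose]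
    field_simp
  have h5 : ((2 * k)! : ℝ) = 4 ^ k * (poch (1 / 2) k * (k ! : ℝ)) := by
    rw [← poch_one, poch_two_mul, ← poch_one k]
    norm_num
  have p1 : 0 < poch D k := poch_pos (by positivity) k
  have p2 : (0 : ℝ) < (2 * k + n).choose n := by exact_mod_cast Nat.choose_pos (by lia)
  have p3 : 0 < poch (1 / 2) k := poch_pos (by norm_num) k
  rw [h4, h5]
  rw [sphereCoeff] at h2
  field_simp at h2 ⊢
  linear_combination h2

end Walk

/-! ### Partial fractions -/

lemma exists_partial_fractions (J : Finset ℕ) (N : ℝ[X]) :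
    ∃ (Q : ℝ[X]) (c : ℕ → ℝ), ∀ s : ℝ, 0 ≤ s →
      N.eval s / ∏ j ∈ J, (s + 1 + j) = Q.eval s + ∑ j ∈ J, c j / (s + 1 + j) := by
  induction J using Finset.induction_on with
  | empty => exact ⟨N, 0, fun s _ => by simp⟩
  | insert a J ha ih =>
    obtain ⟨Q, c, h⟩ := ih
    -- `r` is the remainder of `Q` modulo `X + 1 + a`. The new coefficients come from
    -- `1/((s+1+j)(s+1+a)) = (1/(s+1+j) - 1/(s+1+a)) / (a - j)`.
    set r : ℝ := Q.eval (-(1 + a))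
    refine ⟨Q /ₘ (X - C (-(1 + (a : ℝ)))),
      fun j => if j = a then r - ∑ j ∈ J, c j / (a - j) else c j / (a - j), fun s hs => ?_⟩
    have hsa : s + 1 + a ≠ 0 := by positivity
    have hQ : Q.eval s = (s + 1 + a) * (Q /ₘ (X - C (-(1 + (a : ℝ))))).eval s + r := by
      conv_lhs => rw [← modByMonic_add_div Q (X - C (-(1 + (a : ℝ))))]
      rw [modByMonic_X_sub_C_eq_C_eval, eval_add, eval_C, eval_mul, eval_sub, eval_X, eval_C]
      ring
    have hsum : ∑ j ∈ J, (if j = a then r - ∑ j ∈ J, c j / (a - j) else c j / (a - j)) / (s + 1 + j)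
        = ∑ j ∈ J, c j / (a - j) / (s + 1 + j) :=
      Finset.sum_congr rfl fun j hj => by rw [if_neg (by rintro rfl; exact ha hj)]
    have hterm : (∑ j ∈ J, c j / (s + 1 + j)) / (s + 1 + a) =
        ∑ j ∈ J, c j / (a - j) / (s + 1 + j) - (∑ j ∈ J, c j / (a - j)) / (s + 1 + a) := by
      rw [Finset.sum_div, Finset.sum_div, ← Finset.sum_sub_distrib]
      refine Finset.sum_congr rfl fun j hj => ?_
      have h1 : (a : ℝ) - j ≠ 0 := by
        rw [sub_ne_zero, Ne, Nat.cast_inj]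
        rintro rfl
        exact ha hj
      have h2 : s + 1 + j ≠ 0 := by positivity
      field_simp
      ring
    simp only [Finset.prod_insert ha, Finset.sum_insert ha, hsum, if_true]
    rw [mul_comm, ← div_div, h s hs, add_div, hterm, hQ]
    field_simp
    ring

lemma poch_eq_prod (x : ℝ) (k : ℕ) : poch x k = ∏ j ∈ Finset.range k, (x + j) := by
  induction k with
  | zero => simp [poch_zero]
  | succ k ih => rw [poch_succ, Finset.prod_range_succ, ih]

lemma poch_add (x : ℝ) (a b : ℕ) : poch x (a + b) = poch x a * poch (x + a) b := by
  rw [poch_eq_prod, poch_eq_prod, poch_eq_prod, Finset.prod_range_add]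
  congr 1
  refine Finset.prod_congr rfl fun j _ => ?_
  push_cast
  ring

lemma continuous_poch (k : ℕ) : Continuous fun x => poch x k := (ascPochhammer ℝ k).continuous

/-- `mellinFraction` with the factor `s` cancelled. -/
noncomputable def reducedMellin (D n : ℕ) (s : ℝ) : ℝ :=
  ((n - 1)! : ℝ) / ((D - 1)! : ℝ) * ∑ i ∈ Finset.Icc n (n * (D - 1)),
    (i : ℝ) * coeffP D n i * (poch (s + 1) (D - 1) / poch (s + 1) i) * poch (2 * s + n) (i - n)

/-- The zeros of `(2s)_n` lie among `0, -1/2, -1, …`, so both cancellations are legitimate in this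
range. -/
lemma mellinFraction_eq_reducedMellin {D n : ℕ} (hD : 1 ≤ D) {s : ℝ} (hs0 : s ≠ 0)
    (hs : -(1 / 2) < s) : mellinFraction D n s = reducedMellin D n s := by
  rw [mellinFraction, reducedMellin]
  congr 1
  refine Finset.sum_congr rfl fun i hi => ?_
  obtain ⟨j, rfl⟩ : ∃ j, i = n + j := ⟨i - n, by have := (Finset.mem_Icc.1 hi).1; lia⟩
  obtain ⟨d, rfl⟩ : ∃ d, D = d + 1 := ⟨D - 1, by lia⟩
  have h : poch (2 * s) n ≠ 0 := by
    cases n with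
    | zero => simp [poch_zero]
    | succ n =>
      rw [poch_succ_left]
      exact mul_ne_zero (by simpa using hs0) (poch_pos (by linarith) n).ne'
  rw [poch_succ_left, poch_succ_left, mul_div_mul_left _ _ hs0, poch_add (2 * s) n j,
    mul_div_cancel_left₀ _ h]
  simp

lemma tendsto_mellinFraction {D n : ℕ} (hD : 2 ≤ D) (hn : 1 ≤ n) :
    Filter.Tendsto (mellinFraction D n) (𝓝[≠] 0) (𝓝 1) := by
  have hc : ContinuousAt (reducedMellin D n) 0 := by
    unfold reducedMellin
    refine continuousAt_const.mul (tendsto_finsetSum _ fun i _ => ?_)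
    refine ContinuousAt.mul (continuousAt_const.mul (ContinuousAt.div ?_ ?_ ?_)) ?_
    · exact ((continuous_poch _).comp (continuous_id.add continuous_const)).continuousAt
    · exact ((continuous_poch _).comp (continuous_id.add continuous_const)).continuousAt
    · exact (poch_pos (by norm_num) _).ne'
    · exact ((continuous_poch _).comp
        ((continuous_const.mul continuous_id).add continuous_const)).continuousAt
  have h0 : reducedMellin D n 0 = 1 := by
    rw [← sum_coeffP D n hD, reducedMellin, Finset.mul_sum]
    refine Finset.sum_congr rfl fun i hi => ?_
    obtain ⟨j, rfl⟩ : ∃ j, i = n + j := ⟨i - n, by have := (Finset.mem_Icc.1 hi).1; lia⟩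
    obtain ⟨n, rfl⟩ : ∃ m, n = m + 1 := ⟨n - 1, by lia⟩
    have e1 : poch (2 * 0 + (n + 1 : ℕ)) (n + 1 + j - (n + 1)) = ((n + j)! : ℝ) / (n ! : ℝ) := by
      rw [← poch_natCast_succ]; simp
    have e2 : n + 1 + j = n + j + 1 := by ring
    rw [e1, zero_add, poch_one, poch_one, e2, Nat.factorial_succ (n + j), Nat.add_sub_cancel]
    push_cast
    field_simp
  rw [← h0]
  refine (hc.tendsto.mono_left nhdsWithin_le_nhds).congr' ?_
  filter_upwards [self_mem_nhdsWithin,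
    nhdsWithin_le_nhds (Ioi_mem_nhds (show -(1 / 2) < (0 : ℝ) by norm_num))] with s h1 h2
  exact (mellinFraction_eq_reducedMellin (by lia) h1 h2).symm

lemma reducedMellin_natCast {D n : ℕ} (hD : 1 ≤ D) (hn : 1 ≤ n) (k : ℕ) :
    reducedMellin D n k = poch D k / poch n (2 * k) *
      ∑ i ∈ Finset.Icc n (n * (D - 1)), coeffP D n i *
        (poch i (2 * k) / poch ((i : ℝ) + 1) k) := by
  rw [reducedMellin, Finset.mul_sum, Finset.mul_sum]
  refine Finset.sum_congr rfl fun i hi => ?_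
  obtain ⟨j, rfl⟩ : ∃ j, i = n + j := ⟨i - n, by have := (Finset.mem_Icc.1 hi).1; lia⟩
  obtain ⟨n, rfl⟩ : ∃ m, n = m + 1 := ⟨n - 1, by lia⟩
  obtain ⟨d, rfl⟩ : ∃ d, D = d + 1 := ⟨D - 1, by lia⟩
  have e1 : poch (2 * k + (n + 1 : ℕ)) (n + 1 + j - (n + 1)) =
      ((2 * k + n + j)! : ℝ) / ((2 * k + n)! : ℝ) := by
    rw [← poch_natCast_succ, Nat.add_sub_cancel_left]; push_cast; rw [add_assoc]
  have e2 : poch ((n + 1 + j : ℕ) : ℝ) (2 * k) = ((2 * k + n + j)! : ℝ) / ((n + j)! : ℝ) := by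
    rw [show 2 * k + n + j = n + j + 2 * k by ring, ← poch_natCast_succ]; push_cast
    congr 1; ring
  have e3 : poch ((n + 1 : ℕ) : ℝ) (2 * k) = ((2 * k + n)! : ℝ) / (n ! : ℝ) := by
    rw [show 2 * k + n = n + 2 * k by ring, ← poch_natCast_succ]; push_cast; rfl
  have e4 : poch ((d + 1 : ℕ) : ℝ) k = ((k + d)! : ℝ) / (d ! : ℝ) := by
    rw [show k + d = d + k by ring, ← poch_natCast_succ]; push_cast; rfl
  rw [e1, e2, e3, e4, poch_natCast_succ, poch_natCast_succ, poch_natCast_succ,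
    show n + 1 + j = n + j + 1 by ring, Nat.factorial_succ (n + j), Nat.add_sub_cancel,
    Nat.add_sub_cancel, add_comm (n + j + 1) k]
  push_cast
  field_simp

/-- All terms share the denominator `(s+1)_m` with `m = n(D-1)`, whose zeros are simple. -/
lemma exists_reducedMellin_eq (D n : ℕ) :
    ∃ (Q : ℝ[X]) (c : ℕ → ℝ), ∀ s : ℝ, 0 ≤ s → reducedMellin D n s =
      Q.eval s + ∑ j ∈ Finset.range (n * (D - 1)), c j / (s + 1 + j) := by
  set m := n * (D - 1) with hm
  obtain ⟨Q, c, h⟩ := exists_partial_fractions (Finset.range m)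
    (C (((n - 1)! : ℝ) / ((D - 1)! : ℝ)) * ∑ i ∈ Finset.Icc n m,
      C ((i : ℝ) * coeffP D n i) * ((ascPochhammer ℝ (D - 1)).comp (X + C 1) *
        (ascPochhammer ℝ (m - i)).comp (X + C (1 + (i : ℝ)))) *
        (ascPochhammer ℝ (i - n)).comp (C 2 * X + C (n : ℝ)))
  refine ⟨Q, c, fun s hs => ?_⟩
  rw [← h s hs, reducedMellin, ← poch_eq_prod]
  simp only [eval_mul, eval_C, eval_finsetSum, eval_comp, eval_add, eval_X]
  rw [mul_div_assoc, Finset.sum_div]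
  congr 1
  refine Finset.sum_congr rfl fun i hi => ?_
  have h1 : poch (s + 1) m = poch (s + 1) i * poch (s + (1 + i)) (m - i) := by
    rw [← add_assoc, ← poch_add]
    congr 1
    have := (Finset.mem_Icc.1 hi).2
    lia
  have h2 : 0 < poch (s + 1) i := poch_pos (by positivity) i
  have h3 : 0 < poch (s + (1 + i)) (m - i) := poch_pos (by positivity) _
  rw [h1]
  rw [poch] at h2 h3 ⊢
  simp only [poch] at h3 ⊢
  field_simp

lemma natDegree_eq_zero_of_abs_eval_natCast_le {Q : ℝ[X]} {K : ℝ}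
    (h : ∀ k : ℕ, |Q.eval (k : ℝ)| ≤ K) : Q.natDegree = 0 := by
  by_contra hd
  have ht := (Q.abs_tendsto_atTop
    (natDegree_pos_iff_degree_pos.1 (Nat.pos_of_ne_zero hd))).comp
      (tendsto_natCast_atTop_atTop (R := ℝ))
  obtain ⟨k, hk⟩ := (ht.eventually (Filter.eventually_gt_atTop K)).exists
  exact (h k).not_gt hk

/-! ### Distributions on `[0, 1]` with given moments -/

section Moments

lemma integrableOn_Ioo_of_continuous {g : ℝ → ℝ} (hg : Continuous g) :
    IntegrableOn g (Set.Ioo 0 1) :=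
  hg.continuousOn.integrableOn_Icc.mono_set Set.Ioo_subset_Icc_self

variable {Ω : Type*} [MeasurableSpace Ω] {P : Measure Ω} [IsProbabilityMeasure P] {V : Ω → ℝ}

/-- Linearity gives polynomials, and Weierstrass approximation on `[0, 1]` gives continuous `g`. -/
lemma integral_eq_of_moments (hV : AEMeasurable V P) (h01 : ∀ᵐ ω ∂P, V ω ∈ Set.Icc 0 1) {c : ℝ}
    {f : ℝ[X]} (h : ∀ k : ℕ, ∫ ω, V ω ^ k ∂P = c + ∫ v in Set.Ioo (0 : ℝ) 1, v ^ k * f.eval v)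
    {g : ℝ → ℝ} (hg : Continuous g) :
    ∫ ω, g (V ω) ∂P = c * g 1 + ∫ v in Set.Ioo (0 : ℝ) 1, g v * f.eval v := by
  have hintV : ∀ ψ : ℝ → ℝ, Continuous ψ → Integrable (fun ω => ψ (V ω)) P := by
    intro ψ hψ
    obtain ⟨K, hK⟩ := isCompact_Icc.exists_bound_of_continuousOn
      (hψ.continuousOn (s := Set.Icc (0 : ℝ) 1))
    refine Integrable.of_bound (hψ.measurable.comp_aemeasurable hV).aestronglyMeasurable K ?_
    filter_upwards [h01] with ω hω using hK _ hω
  have hintf : ∀ ψ : ℝ → ℝ, Continuous ψ →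
      Integrable (fun v => ψ v * f.eval v) (volume.restrict (Set.Ioo (0 : ℝ) 1)) :=
    fun ψ hψ => integrableOn_Ioo_of_continuous (hψ.mul f.continuous)
  have hpoly : ∀ p : ℝ[X], ∫ ω, p.eval (V ω) ∂P =
      c * p.eval 1 + ∫ v in Set.Ioo (0 : ℝ) 1, p.eval v * f.eval v := by
    intro p
    induction p using Polynomial.induction_on' with
    | add p q hp hq =>
      simp only [eval_add, add_mul]
      rw [integral_add (hintV _ p.continuous) (hintV _ q.continuous),
        integral_add (hintf _ p.continuous) (hintf _ q.continuous), hp, hq]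
      ring
    | monomial k a =>
      simp only [eval_monomial, mul_assoc]
      rw [integral_const_mul, integral_const_mul, h]
      ring
  set I := ∫ v in Set.Ioo (0 : ℝ) 1, |f.eval v| with hI
  have hI0 : 0 ≤ I := integral_nonneg fun v => abs_nonneg _
  refine eq_of_forall_dist_le fun δ hδ => ?_
  -- A uniform error `ε` costs at most `ε` under `P`, `|c| ε` at the point `1`, and `ε I` against
  -- `f`.
  have hK : 0 < 1 + |c| + I := by positivity
  obtain ⟨p, hp⟩ := exists_polynomial_near_of_continuousOn 0 1 g hg.continuousOn
    (δ / (1 + |c| + I)) (by positivity)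
  set ε := δ / (1 + |c| + I)
  have h1 : |∫ ω, (g (V ω) - p.eval (V ω)) ∂P| ≤ ε := by
    have := norm_integral_le_of_norm_le_const (μ := P) (f := fun ω => g (V ω) - p.eval (V ω))
      (C := ε) (by
        filter_upwards [h01] with ω hω
        rw [Real.norm_eq_abs, abs_sub_comm]
        exact (hp _ hω).le)
    simpa using this
  have h2 : |∫ v in Set.Ioo (0 : ℝ) 1, (g v - p.eval v) * f.eval v| ≤ ε * I := by
    rw [hI, ← integral_const_mul, ← Real.norm_eq_abs]
    refine norm_integral_le_of_norm_le ((integrableOn_Ioo_of_continuous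
      f.continuous.abs).const_mul ε) ?_
    filter_upwards [ae_restrict_mem measurableSet_Ioo] with v hv
    rw [Real.norm_eq_abs, abs_mul, abs_sub_comm]
    exact mul_le_mul_of_nonneg_right (hp v ⟨hv.1.le, hv.2.le⟩).le (abs_nonneg _)
  have h3 : |c * (g 1 - p.eval 1)| ≤ |c| * ε := by
    rw [abs_mul, abs_sub_comm]
    exact mul_le_mul_of_nonneg_left (hp 1 (by simp)).le (abs_nonneg _)
  rw [integral_sub (hintV _ hg) (hintV _ p.continuous), hpoly] at h1
  simp only [sub_mul] at h2
  rw [integral_sub (hintf _ hg) (hintf _ p.continuous)] at h2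
  have h4 : ε * (1 + |c| + I) = δ := div_mul_cancel₀ _ hK.ne'
  rw [Real.dist_eq, abs_le]
  rw [abs_le] at h1 h2 h3
  constructor <;> linarith [h1.1, h1.2, h2.1, h2.2, h3.1, h3.2]

/-- The sign of `f` is not known beforehand, so the law plus the density `f⁻` is compared with the
density `f⁺`, both being finite positive measures. -/
lemma map_eq_withDensity_of_moments (hV : AEMeasurable V P)
    (h01 : ∀ᵐ ω ∂P, V ω ∈ Set.Icc 0 1) {f : ℝ[X]}
    (h : ∀ k : ℕ, ∫ ω, V ω ^ k ∂P = ∫ v in Set.Ioo (0 : ℝ) 1, v ^ k * f.eval v) :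
    (∀ v ∈ Set.Ioo (0 : ℝ) 1, 0 ≤ f.eval v) ∧
      P.map V = (volume.restrict (Set.Ioo (0 : ℝ) 1)).withDensity
        fun v => ENNReal.ofReal (f.eval v) := by
  set ν : Measure ℝ := volume.restrict (Set.Ioo (0 : ℝ) 1) with hν
  have hfin : ∀ g : ℝ[X], IsFiniteMeasure (ν.withDensity fun v => ENNReal.ofReal (g.eval v)) :=
    fun g => isFiniteMeasure_withDensity_ofReal
      (integrableOn_Ioo_of_continuous g.continuous).hasFiniteIntegral
  have hmeas : ∀ q : ℝ[X], Measurable fun v => ENNReal.ofReal (q.eval v) := fun q =>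
    q.continuous.measurable.ennreal_ofReal
  have hfp := hfin f
  have hfn := hfin (-f)
  have hprob : IsProbabilityMeasure (P.map V) := Measure.isProbabilityMeasure_map hV
  have key : P.map V + (ν.withDensity fun v => ENNReal.ofReal ((-f).eval v)) =
      ν.withDensity fun v => ENNReal.ofReal (f.eval v) := by
    refine ext_of_forall_integral_eq_of_IsFiniteMeasure fun g => ?_
    have hd : ∀ q : ℝ[X], ∫ v, g v ∂(ν.withDensity fun v => ENNReal.ofReal (q.eval v)) =
        ∫ v, max (q.eval v) 0 * g v ∂ν := by
      intro q
      rw [integral_withDensity_eq_integral_toReal_smul (hmeas q) (by simp)]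
      simp only [ENNReal.toReal_ofReal', smul_eq_mul]
    have hi : ∀ q : ℝ[X], Integrable (fun v => max (q.eval v) 0 * g v) ν := fun q =>
      integrableOn_Ioo_of_continuous ((q.continuous.max continuous_const).mul g.continuous)
    have hm := integral_eq_of_moments hV h01 (c := 0) (by simpa using h) g.continuous
    rw [integral_add_measure (g.integrable _) (g.integrable _), hd, hd,
      integral_map hV g.continuous.aestronglyMeasurable, hm, zero_mul, zero_add,
      ← eq_sub_iff_add_eq, ← integral_sub (hi _) (hi _)]
    refine integral_congr_ae (ae_of_all _ fun v => ?_)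
    have : max (f.eval v) 0 - max ((-f).eval v) 0 = f.eval v := by
      rw [eval_neg, max_comm, max_comm (-f.eval v)]
      exact max_zero_sub_max_neg_zero_eq_self (f.eval v) |> fun h => by simpa [max_comm] using h
    simp only [← sub_mul, this]
    ring
  have hnonneg : ∀ v ∈ Set.Ioo (0 : ℝ) 1, 0 ≤ f.eval v := by
    -- On `A` the density `f⁺` vanishes, hence so does the mass of `f⁻`; `A` is then null, and being
    -- open it is empty.
    set A : Set ℝ := Set.Ioo 0 1 ∩ {v | f.eval v < 0} with hA
    have hAo : IsOpen A := isOpen_Ioo.inter (isOpen_lt f.continuous continuous_const)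
    have h1 : (ν.withDensity fun v => ENNReal.ofReal (f.eval v)) A = 0 := by
      rw [withDensity_apply _ hAo.measurableSet, setLIntegral_congr_fun (g := fun _ => 0)
        hAo.measurableSet fun v hv => ENNReal.ofReal_eq_zero.2 (le_of_lt hv.2)]
      simp
    have h2 : (ν.withDensity fun v => ENNReal.ofReal ((-f).eval v)) A = 0 := by
      have := congrArg (fun m : Measure ℝ => m A) key
      simp only [Measure.add_apply, h1, add_eq_zero] at this
      exact this.2
    rw [withDensity_apply _ hAo.measurableSet, setLIntegral_eq_zero_iff hAo.measurableSet
      (hmeas (-f))] at h2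
    have h3 : volume A = 0 := by
      have h4 : ν A = volume A := by
        rw [hν, Measure.restrict_apply hAo.measurableSet, Set.inter_eq_left.2]
        exact Set.inter_subset_left
      rw [← h4, ← compl_compl A, ← mem_ae_iff]
      filter_upwards [h2] with v hv hvA
      have := ENNReal.ofReal_eq_zero.1 (hv hvA)
      rw [eval_neg] at this
      linarith [show f.eval v < 0 from hvA.2]
    have h5 := hAo.measure_eq_zero_iff volume |>.1 h3
    intro v hv
    by_contra hlt
    exact Set.notMem_empty v (h5 ▸ (⟨hv, not_le.1 hlt⟩ : v ∈ A))
  refine ⟨hnonneg, ?_⟩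
  have hzero : (ν.withDensity fun v => ENNReal.ofReal ((-f).eval v)) = 0 := by
    rw [withDensity_eq_zero_iff (hmeas (-f)).aemeasurable]
    filter_upwards [ae_restrict_mem measurableSet_Ioo] with v hv
    rw [eval_neg]
    exact ENNReal.ofReal_eq_zero.2 (neg_nonpos.2 (hnonneg v hv))
  rw [← key, hzero, add_zero]

end Moments

/-! ### The squared radius -/

lemma sphereCoeff_le {D : ℕ} (hD : 2 ≤ D) (k : ℕ) : sphereCoeff D k ≤ 1 / ((k : ℝ) + 1) := by
  have hD' : (2 : ℝ) ≤ D := by exact_mod_cast hD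
  have h1 : poch (1 / 2) k ≤ (k ! : ℝ) := by
    rw [← poch_one]; exact poch_le_poch (by norm_num) (by norm_num) k
  have h2 : ((k + 1)! : ℝ) ≤ poch D k := by
    have h := poch_le_poch (by norm_num) hD' k
    have h' := poch_natCast_succ 1 k
    norm_num [add_comm 1 k] at h'
    rwa [h'] at h
  have h3 : (0 : ℝ) < k ! := by positivity
  rw [sphereCoeff, div_le_div_iff₀ (poch_pos (by linarith) k) (by positivity), one_mul]
  refine le_trans ?_ h2
  rw [Nat.factorial_succ]
  push_cast
  nlinarith

/-- The indicator of `{x}` is at most `⟨x, θ⟩^(2k)` for every `k`, and these moments tend to `0`. -/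
lemma sphereUniform_singleton {D : ℕ} (hD : 2 ≤ D) {x : EuclideanSpace ℝ (Fin (2 * D))}
    (hx : ‖x‖ = 1) : sphereUniform (2 * D) {x} = 0 := by
  have hprob := isProbabilityMeasure_sphereUniform (show 0 < 2 * D by lia)
  have h : ∀ k : ℕ, (sphereUniform (2 * D)).real {x} ≤ 1 / ((k : ℝ) + 1) := by
    intro k
    refine le_trans ?_ (sphereCoeff_le hD k)
    have h1 := integral_inner_pow_sphereUniform (show 1 ≤ D by lia) x k
    rw [hx, one_pow, one_mul] at h1
    rw [← h1, ← integral_indicator_one (measurableSet_singleton x)]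
    refine integral_mono_of_nonneg (ae_of_all _ fun θ => Set.indicator_nonneg (by simp) θ)
      (integrable_pow_of_abs_le_one (by fun_prop)
        (by simpa [hx] using ae_abs_inner_le_sphereUniform x) _) (ae_of_all _ fun θ => ?_)
    by_cases hθ : θ = x
    · subst hθ
      simp [hx]
    · rw [Set.indicator_of_notMem (by simpa using hθ)]
      exact (even_two_mul k).pow_nonneg _
  have h0 : (sphereUniform (2 * D)).real {x} ≤ 0 :=
    ge_of_tendsto' tendsto_one_div_add_atTop_nhds_zero_nat h
  exact (measureReal_eq_zero_iff).1 (le_antisymm h0 measureReal_nonneg)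

lemma integral_Ioo_rpow_mul_eval_sum (m : ℕ) (c : ℕ → ℝ) {s : ℝ} (hs : 0 ≤ s) :
    ∫ v in Set.Ioo (0 : ℝ) 1, v ^ s * (∑ j ∈ Finset.range m, C (c j) * X ^ j : ℝ[X]).eval v =
      ∑ j ∈ Finset.range m, c j / (s + 1 + j) := by
  simp only [eval_finsetSum, eval_mul, eval_C, eval_pow, eval_X, Finset.mul_sum]
  rw [integral_finsetSum]
  · refine Finset.sum_congr rfl fun j _ => ?_
    have h1 : ∫ v in Set.Ioo (0 : ℝ) 1, v ^ s * (c j * v ^ j) =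
        ∫ v in Set.Ioo (0 : ℝ) 1, c j * v ^ (s + j) := by
      refine setIntegral_congr_fun measurableSet_Ioo fun v hv => ?_
      rw [Real.rpow_add hv.1, Real.rpow_natCast]
      ring
    have hj : -1 < s + j := by linarith [(Nat.cast_nonneg j : (0 : ℝ) ≤ j)]
    rw [h1, integral_const_mul, ← integral_Ioc_eq_integral_Ioo,
      ← intervalIntegral.integral_of_le zero_le_one, integral_rpow (Or.inl hj), Real.one_rpow,
      Real.zero_rpow (by linarith)]
    rw [sub_zero, mul_one_div]
    congr 1
    ring
  · intro j _
    exact integrableOn_Ioo_of_continuous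
      ((Real.continuous_rpow_const hs).mul (continuous_const.mul (continuous_pow j)))

section Walk

variable {Ω : Type*} [MeasurableSpace Ω] {P : Measure Ω} {D n : ℕ}
  {X : Ω → Fin n → ℝ} {Θ : Fin n → Ω → EuclideanSpace ℝ (Fin (2 * D))}

lemma IsDirichletWalk.ae_norm_sq_mem_Icc (hn : 1 ≤ n)
    (hW : IsDirichletWalk P (fun _ => 1) X Θ) :
    ∀ᵐ ω ∂P, ‖walk X Θ ω‖ ^ 2 ∈ Set.Icc 0 1 := by
  filter_upwards [hW.ae_norm_walk_le hn] with ω hω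
  exact ⟨by positivity, pow_le_one₀ (norm_nonneg _) hω⟩

variable [IsProbabilityMeasure P]

lemma IsDirichletWalk.ae_direction_ne (hD : 2 ≤ D) (hW : IsDirichletWalk P (fun _ => 1) X Θ)
    {i j : Fin n} (hij : i ≠ j) : ∀ᵐ ω ∂P, Θ i ω ≠ Θ j ω := by
  have hprob := isProbabilityMeasure_sphereUniform (show 0 < 2 * D by lia)
  have hlaw := IndepFun.hasLaw_prod (hW.hasLaw_direction i) (hW.hasLaw_direction j)
    (hW.iIndepFun_direction.indepFun hij)
  have hmeas : MeasurableSet {p : EuclideanSpace ℝ (Fin (2 * D)) × EuclideanSpace ℝ (Fin (2 * D)) |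
      p.1 = p.2} := measurableSet_eq_fun measurable_fst measurable_snd
  have h : ∀ᵐ p ∂((sphereUniform (2 * D)).prod (sphereUniform (2 * D))), p.1 ≠ p.2 := by
    rw [ae_iff]
    simp only [ne_eq, not_not]
    rw [Measure.measure_prod_null hmeas]
    filter_upwards [ae_norm_eq_one_sphereUniform (2 * D)] with x hx
    have hset : Prod.mk x ⁻¹' {p : EuclideanSpace ℝ (Fin (2 * D)) ×
        EuclideanSpace ℝ (Fin (2 * D)) | p.1 = p.2} = {x} := by
      ext y
      simp [eq_comm]
    rw [hset]
    exact sphereUniform_singleton hD hx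
  rw [← hlaw.map_eq] at h
  exact ae_of_ae_map hlaw.aemeasurable h

/-- Equality case of the triangle inequality: `‖w‖ = 1` gives `∑ Xⱼ (1 - ⟨w, Θⱼ⟩) = 0` with
nonnegative terms and `Xⱼ > 0`, so all directions equal `w`. -/
lemma IsDirichletWalk.ae_norm_walk_lt (hD : 2 ≤ D) (hn : 2 ≤ n)
    (hW : IsDirichletWalk P (fun _ => 1) X Θ) : ∀ᵐ ω ∂P, ‖walk X Θ ω‖ < 1 := by
  filter_upwards [hW.ae_weights (by lia), hW.ae_norm_direction, hW.ae_norm_walk_le (by lia),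
    hW.ae_direction_ne hD (i := ⟨0, by lia⟩) (j := ⟨1, by lia⟩) (by simp)] with ω h1 h2 h3 h4
  refine lt_of_le_of_ne h3 fun h5 => h4 ?_
  set w := walk X Θ ω with hw
  have hle : ∀ j, inner ℝ w (Θ j ω) ≤ 1 := fun j => by
    simpa [h5, h2 j] using real_inner_le_norm w (Θ j ω)
  have hsum : ∑ j, X ω j * (1 - inner ℝ w (Θ j ω)) = 0 := by
    have h6 : inner ℝ w w = (1 : ℝ) := by rw [real_inner_self_eq_norm_sq, h5, one_pow]
    have h7 : inner ℝ w w = ∑ j, X ω j * inner ℝ w (Θ j ω) := by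
      conv_lhs => enter [3]; rw [hw, walk]
      simp only [inner_sum, real_inner_smul_right]
    simp only [mul_sub, mul_one, Finset.sum_sub_distrib]
    rw [h1.2, ← h7, h6, sub_self]
  have heq : ∀ j, w = Θ j ω := by
    intro j
    have h8 := (Finset.sum_eq_zero_iff_of_nonneg fun j _ =>
      mul_nonneg (h1.1 j).le (sub_nonneg.2 (hle j))).1 hsum j (Finset.mem_univ j)
    have h9 := (mul_eq_zero.1 h8).resolve_left (h1.1 j).ne'
    exact (inner_eq_one_iff_of_norm_eq_one (𝕜 := ℝ) h5 (h2 j)).1 (by linarith)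
  rw [← heq, ← heq]

/-- The law of `R²` is `c δ₁ + f(v) 1_{(0,1)}(v) dv` with a polynomial `f`. -/
lemma IsDirichletWalk.exists_moments (hD : 2 ≤ D) (hn : 1 ≤ n)
    (hW : IsDirichletWalk P (fun _ => 1) X Θ) :
    ∃ (c : ℝ) (f : ℝ[X]),
      (∀ k : ℕ, ∫ ω, (‖walk X Θ ω‖ ^ 2) ^ k ∂P =
        c + ∫ v in Set.Ioo (0 : ℝ) 1, v ^ k * f.eval v) ∧
      (∀ s : ℝ, 0 ≤ s → reducedMellin D n s =
        c + ∫ v in Set.Ioo (0 : ℝ) 1, v ^ s * f.eval v) ∧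
      (Filter.Tendsto (fun k : ℕ => ∫ ω, (‖walk X Θ ω‖ ^ 2) ^ k ∂P) Filter.atTop (𝓝 c)) := by
  obtain ⟨Q, c, h⟩ := exists_reducedMellin_eq D n
  set m := n * (D - 1)
  have hmom : ∀ k : ℕ, ∫ ω, (‖walk X Θ ω‖ ^ 2) ^ k ∂P = reducedMellin D n k := by
    intro k
    simp only [← pow_mul]
    rw [hW.integral_norm_pow hD hn k, reducedMellin_natCast (by lia) hn k]
  have hle : ∀ k : ℕ, |∫ ω, (‖walk X Θ ω‖ ^ 2) ^ k ∂P| ≤ 1 := by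
    intro k
    have := norm_integral_le_of_norm_le_const (μ := P) (f := fun ω => (‖walk X Θ ω‖ ^ 2) ^ k)
      (C := 1) (by
        filter_upwards [hW.ae_norm_walk_le hn] with ω hω
        rw [Real.norm_eq_abs, abs_of_nonneg (by positivity)]
        exact pow_le_one₀ (by positivity) (pow_le_one₀ (norm_nonneg _) hω))
    simpa using this
  -- The moments and the simple fractions are bounded at the integers, hence so is `Q`.
  have hQ : Q.natDegree = 0 := by
    refine natDegree_eq_zero_of_abs_eval_natCast_le (K := 1 + ∑ j ∈ Finset.range m, |c j|)
      fun k => ?_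
    have h1 := h k (by positivity)
    have h2 : |∑ j ∈ Finset.range m, c j / ((k : ℝ) + 1 + j)| ≤ ∑ j ∈ Finset.range m, |c j| := by
      refine (Finset.abs_sum_le_sum_abs _ _).trans (Finset.sum_le_sum fun j _ => ?_)
      rw [abs_div, abs_of_pos (show (0 : ℝ) < k + 1 + j by positivity)]
      refine div_le_self (abs_nonneg _) ?_
      linarith [(Nat.cast_nonneg j : (0 : ℝ) ≤ j), (Nat.cast_nonneg k : (0 : ℝ) ≤ k)]
    have h3 := hle k
    rw [hmom, h1] at h3
    rw [abs_le] at *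
    constructor <;> linarith [h2.1, h2.2, h3.1, h3.2]
  obtain ⟨q, rfl⟩ := natDegree_eq_zero.1 hQ
  simp only [eval_C] at h
  -- Each fraction `1 / (s + 1 + j)` is `∫₀¹ v^(s+j) dv`, so the residues are the coefficients of
  -- the density.
  refine ⟨q, ∑ j ∈ Finset.range m, C (c j) * Polynomial.X ^ j, fun k => ?_, fun s hs => ?_, ?_⟩
  · rw [hmom, h k (by positivity), ← integral_Ioo_rpow_mul_eval_sum m c (Nat.cast_nonneg k)]
    simp only [Real.rpow_natCast]
  · rw [h s hs, integral_Ioo_rpow_mul_eval_sum m c hs]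
  · simp only [hmom, h _ (Nat.cast_nonneg _)]
    have h3 : Filter.Tendsto (fun k : ℕ => ∑ j ∈ Finset.range m, c j / ((k : ℝ) + 1 + j))
        Filter.atTop (𝓝 (∑ j ∈ Finset.range m, 0)) := by
      refine tendsto_finsetSum _ fun j _ => Filter.Tendsto.const_div_atTop ?_ _
      exact Filter.tendsto_atTop_add_const_right _ _
        (Filter.tendsto_atTop_add_const_right _ _ tendsto_natCast_atTop_atTop)
    simpa using h3.const_add q

lemma IsDirichletWalk.tendsto_moments_zero (hD : 2 ≤ D) (hn : 2 ≤ n)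
    (hW : IsDirichletWalk P (fun _ => 1) X Θ) :
    Filter.Tendsto (fun k : ℕ => ∫ ω, (‖walk X Θ ω‖ ^ 2) ^ k ∂P) Filter.atTop (𝓝 0) := by
  have h := tendsto_integral_of_dominated_convergence (μ := P)
    (F := fun (k : ℕ) ω => (‖walk X Θ ω‖ ^ 2) ^ k) (f := fun _ => 0) (fun _ => 1)
    (fun k => ((hW.aemeasurable_walk.norm.pow_const 2).pow_const k).aestronglyMeasurable)
    (integrable_const _) (fun k => by
      filter_upwards [hW.ae_norm_walk_lt hD hn] with ω hω
      rw [Real.norm_eq_abs, abs_of_nonneg (by positivity)]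
      exact pow_le_one₀ (by positivity) (pow_le_one₀ (norm_nonneg _) hω.le)) (by
      filter_upwards [hW.ae_norm_walk_lt hD hn] with ω hω
      exact tendsto_pow_atTop_nhds_zero_of_lt_one (by positivity)
        (pow_lt_one₀ (norm_nonneg _) hω (by norm_num)))
  simpa using h

lemma IsDirichletWalk.integral_norm_rpow (hD : 2 ≤ D) (hn : 1 ≤ n)
    (hW : IsDirichletWalk P (fun _ => 1) X Θ) {s : ℝ} (hs : 0 < s) :
    ∫ ω, ‖walk X Θ ω‖ ^ (2 * s) ∂P = mellinFraction D n s := by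
  obtain ⟨c, f, hmom, hmel, -⟩ := hW.exists_moments hD hn
  rw [mellinFraction_eq_reducedMellin (by lia) hs.ne' (by linarith), hmel s hs.le]
  have h := integral_eq_of_moments (hW.aemeasurable_walk.norm.pow_const 2)
    (hW.ae_norm_sq_mem_Icc hn) hmom (Real.continuous_rpow_const hs.le)
  simp only [Real.one_rpow, mul_one] at h
  rw [← h]
  refine integral_congr_ae (ae_of_all _ fun ω => ?_)
  simp only [Real.rpow_mul (norm_nonneg _), Real.rpow_two]

end Walk

end DirichletWalk

/-! ### Assembly of the theorem. -/

theorem theorem13 {Ω : Type*} [MeasurableSpace Ω] (P : Measure Ω) [IsProbabilityMeasure P]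
    (D n : ℕ) (hD : 2 ≤ D) (hn : 1 ≤ n)
    (X : Ω → Fin n → ℝ) (Θ : Fin n → Ω → EuclideanSpace ℝ (Fin (2 * D)))
    (hW : DirichletWalk.IsDirichletWalk P (fun _ => 1) X Θ) :
    -- the numbers `B_k` are those of the expansion of `₂F₁(1/2, 1; D; 4u - 4u²)`
    (∀ u : ℝ, 0 < u → u < 1 / 2 →
      ₂F₁ (1 / 2 : ℝ) 1 (D : ℝ) (4 * u - 4 * u ^ 2) =
        ∑ k ∈ Finset.Icc 1 (D - 1), DirichletWalk.coeffB D k / (1 - u) ^ k) ∧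
    -- the transform `T_n(W)`
    (∀ y : EuclideanSpace ℝ (Fin (2 * D)), ‖y‖ < 1 →
      Integrable (fun ω => 1 / (1 + inner ℝ y (DirichletWalk.walk X Θ ω)) ^ (n : ℝ)) P ∧
      DirichletWalk.stieltjesT P n (DirichletWalk.walk X Θ) y =
        ∑ i ∈ Finset.Icc n (n * (D - 1)), DirichletWalk.coeffP D n i *
          ₂F₁ ((i : ℝ) / 2) (((i : ℝ) + 1) / 2) ((i : ℝ) + 1) (‖y‖ ^ 2)) ∧
    -- the moments of the squared radius
    (∀ k : ℕ,
      Integrable (fun ω => ‖DirichletWalk.walk X Θ ω‖ ^ (2 * k)) P ∧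
      ∫ ω, ‖DirichletWalk.walk X Θ ω‖ ^ (2 * k) ∂P =
        DirichletWalk.poch D k / DirichletWalk.poch n (2 * k) *
          ∑ i ∈ Finset.Icc n (n * (D - 1)), DirichletWalk.coeffP D n i *
            (DirichletWalk.poch i (2 * k) / DirichletWalk.poch ((i : ℝ) + 1) k)) ∧
    -- the Mellin transform of the squared radius, for `s > 0`
    (∀ s : ℝ, 0 < s →
      Integrable (fun ω => ‖DirichletWalk.walk X Θ ω‖ ^ (2 * s)) P ∧
      ∫ ω, ‖DirichletWalk.walk X Θ ω‖ ^ (2 * s) ∂P = DirichletWalk.mellinFraction D n s) ∧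
    -- at `s = 0` the fraction has a removable singularity, with the value `𝔼 R^0 = 1`
    Filter.Tendsto (DirichletWalk.mellinFraction D n) (𝓝[≠] 0) (𝓝 1) ∧
    -- for `n ≥ 2` the squared radius has a polynomial density on `(0, 1)`
    (2 ≤ n → ∃ f : Polynomial ℝ, (∀ v ∈ Set.Ioo (0 : ℝ) 1, 0 ≤ f.eval v) ∧
      P.map (fun ω => ‖DirichletWalk.walk X Θ ω‖ ^ 2) =
        (volume.restrict (Set.Ioo (0 : ℝ) 1)).withDensity
          (fun v => ENNReal.ofReal (f.eval v))) := by
  refine ⟨fun u h0 h1 => ?_, fun y hy => ⟨?_, ?_⟩, fun k => ⟨?_, hW.integral_norm_pow hD hn k⟩,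
    fun s hs => ⟨?_, hW.integral_norm_rpow hD hn hs⟩, DirichletWalk.tendsto_mellinFraction hD hn,
    fun hn2 => ?_⟩
  · rw [DirichletWalk.generatingB_eval_eq_hypergeometric D hD h0.le h1,
      DirichletWalk.eval_generatingB]
    simp only [inv_pow, div_eq_mul_inv]
  · simp only [Real.rpow_natCast]
    exact DirichletWalk.integrable_one_div_one_add_pow hW.aemeasurable_walk.const_inner hy
      (hW.ae_abs_inner_walk_le hn y) n
  · obtain ⟨u, h0, h1, hu⟩ := DirichletWalk.exists_parameter
      (show |‖y‖| < 1 by rwa [abs_of_nonneg (norm_nonneg y)])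
    simp only [DirichletWalk.stieltjesT, Real.rpow_natCast]
    rw [hW.integral_one_div_pow_eq_sum hD hn y hy h0 h1 hu]
    refine Finset.sum_congr rfl fun i _ => ?_
    rw [DirichletWalk.hypergeometric_ballot_eq_tsum, ← hu,
      (DirichletWalk.hasSum_ballotCoeff i h0 h1).tsum_eq]
  · refine DirichletWalk.integrable_pow_of_abs_le_one hW.aemeasurable_walk.norm ?_ (2 * k)
    filter_upwards [hW.ae_norm_walk_le hn] with ω hω
    rwa [abs_of_nonneg (norm_nonneg _)]
  · refine Integrable.of_bound (hW.aemeasurable_walk.norm.pow_const _).aestronglyMeasurable 1 ?_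
    filter_upwards [hW.ae_norm_walk_le hn] with ω hω
    rw [Real.norm_eq_abs, abs_of_nonneg (by positivity)]
    exact Real.rpow_le_one (norm_nonneg _) hω (by positivity)
  · obtain ⟨c, f, hmom, -, hlim⟩ := hW.exists_moments hD hn
    -- The moments tend both to the atom `c` at `1` and to `0`, because `R < 1` almost surely.
    obtain rfl : c = 0 := tendsto_nhds_unique hlim (hW.tendsto_moments_zero hD hn2)
    exact ⟨f, DirichletWalk.map_eq_withDensity_of_moments
      (hW.aemeasurable_walk.norm.pow_const 2) (hW.ae_norm_sq_mem_Icc hn) (by simpa using hmom)⟩
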